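/- Let $\mathcal I=(x_-,x_+)\subset\mathbb R$ be a bounded interval, $x_-<x_+$, with midpoint $y=\frac{x_-+x_+}{2}$, and let $\alpha\in\mathbb R$. For $\beta_-,\beta_+\in\mathbb R$ consider in the complex Hilbert space $L^2(\mathcal I)$ the densely defined sesquilinear forms $$\mathfrak h^D_{\mathcal I,\alpha}[u,v]=(u',v')_{L^2(\mathcal I)}+\alpha\,u(y)\overline{v(y)},\qquad \operatorname{dom}\mathfrak h^D_{\mathcal I,\alpha}=W^{1,2}_0(\mathcal I),$$ $$\mathfrak h^R_{\mathcal I,\alpha,\beta_-,\beta_+}[u,v]=(u',v')_{L^2(\mathcal I)}+\alpha\,u(y)\overline{v(y)}+\tfrac12\bigl(\beta_-u(x_-)\overline{v(x_-)}+\beta_+u(x_+)\overline{v(x_+)}\bigr),\qquad \operatorname{dom}\mathfrak h^R_{\mathcal I,\alpha,\beta_-,\beta_+}=W^{1,2}(\mathcal I),$$ where point values are those of the continuous representative on $\overline{\mathcal I}$. Let $H^D_{\mathcal I,\alpha}$ and $H^R_{\mathcal I,\alpha,\beta_-,\beta_+}$ be the operators associated with these forms: for a form $\mathfrak h$ the associated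 operator $H$ has as its domain all $u\in\operatorname{dom}\mathfrak h$ for which there is $f\in L^2(\mathcal I)$ with $\mathfrak h[u,v]=(f,v)_{L^2(\mathcal I)}$ for all $v\in\operatorname{dom}\mathfrak h$, and $Hu=f$. Then: 1. $H^D_{\mathcal I,\alpha}$ and, for all $\beta_-,\beta_+\in\mathbb R$, $H^R_{\mathcal I,\alpha,\beta_-,\beta_+}$ are self-adjoint, and their spectra are purely discrete (they consist of isolated eigenvalues of finite multiplicity), bounded from below and accumulate at $+\infty$. 2. Let $\lambda_j(H)$, $j=1,2,\dots$, denote the $j$-th eigenvalue of such an operator $H$, where the eigenvalues are counted with multiplicities and ordered as a nondecreasing sequence. Then for every $j\in\mathbb N$ $$\lambda_j\bigl(H^R_{\mathcal I,\alpha,\beta_-,\beta_+}\bigr)\to\lambda_j\bigl(H^D_{\mathcal I,\alpha}\bigr)\quad\text{as }\min\{\beta_-,\beta_+\}\to+\infty .$$ -/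

import Mathlib

open MeasureTheory Set Filter Topology
open scoped ContDiff

/-! ### Unbounded operators in a Hilbert space: spectrum, eigenvalues, forms -/

namespace UnboundedOp

variable {H : Type*} [NormedAddCommGroup H] [InnerProductSpace ℂ H]

/-- The resolvent set of a partially defined operator `A`: those `z` for which `A - z` has an
everywhere defined bounded inverse `R`. -/
def resolventSet (A : H →ₗ.[ℂ] H) : Set ℂ :=
  {z | ∃ R : H →L[ℂ] H,
    (∀ f : H, ∃ hf : R f ∈ A.domain, A ⟨R f, hf⟩ - z • R f = f) ∧
    (∀ u : A.domain, R (A u - z • (u : H)) = u)}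

/-- The spectrum of a partially defined operator. -/
def spectrum (A : H →ₗ.[ℂ] H) : Set ℂ := (resolventSet A)ᶜ

/-- The eigenspace `{u ∈ dom A : A u = μ u}`. -/
def eigenspace (A : H →ₗ.[ℂ] H) (μ : ℂ) : Submodule ℂ H :=
  A.graph.comap (LinearMap.id.prod (μ • LinearMap.id))

theorem mem_eigenspace {A : H →ₗ.[ℂ] H} {μ : ℂ} {u : H} :
    u ∈ eigenspace A μ ↔ ∃ hu : u ∈ A.domain, A ⟨u, hu⟩ = μ • u := by
  simp [eigenspace, LinearPMap.mem_graph_iff]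

/-- The spectrum of `A` is purely discrete (it consists of isolated eigenvalues of finite
multiplicity), bounded from below, and accumulates at `+∞`. -/
structure HasPurelyDiscreteSpectrum (A : H →ₗ.[ℂ] H) : Prop where
  isolated : ∀ z ∈ spectrum A, ¬ AccPt z (𝓟 (spectrum A))
  isEigenvalue : ∀ z ∈ spectrum A, eigenspace A z ≠ ⊥
  finiteDimensional : ∀ z ∈ spectrum A, FiniteDimensional ℂ (eigenspace A z)
  bddBelow : BddBelow {t : ℝ | (t : ℂ) ∈ spectrum A}
  not_bddAbove : ¬ BddAbove {t : ℝ | (t : ℂ) ∈ spectrum A}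

/-- The `j`-th eigenvalue (`j = 1, 2, …`) of a self-adjoint operator with purely discrete spectrum
bounded from below, in nondecreasing order and counted with multiplicities: the least `t` such
that the eigenspaces for the eigenvalues `≤ t` span a space of dimension at least `j`. -/
noncomputable def nthEigenvalue (A : H →ₗ.[ℂ] H) (j : ℕ) : ℝ :=
  sInf {t : ℝ | (j : Cardinal) ≤
    Module.rank ℂ ↥(⨆ μ : ℝ, ⨆ _ : μ ≤ t, eigenspace A (μ : ℂ))}

variable (H) in
/-- A densely defined sesquilinear form (linear in the first, antilinear in the second argument). -/
structure DenseForm where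
  /-- the form domain -/
  domain : Submodule ℂ H
  /-- the form -/
  form : domain →ₗ[ℂ] domain →ₛₗ[starRingEnd ℂ] ℂ
  dense : Dense (domain : Set H)

namespace DenseForm

/-- The graph of the operator associated with the form `h`: all `(u, f)` with `u ∈ dom h` and
`h[u, v] = (f, v)` for all `v ∈ dom h`. -/
def opGraph (h : DenseForm H) : Submodule ℂ (H × H) where
  carrier := {p | ∃ hu : p.1 ∈ h.domain, ∀ v : h.domain,
    h.form ⟨p.1, hu⟩ v = inner ℂ (v : H) p.2}
  zero_mem' := ⟨h.domain.zero_mem, fun v => by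
    have : (⟨(0 : H × H).1, h.domain.zero_mem⟩ : h.domain) = 0 := rfl
    rw [this]; simp⟩
  add_mem' := by
    rintro ⟨u, f⟩ ⟨u', f'⟩ ⟨hu, huf⟩ ⟨hu', huf'⟩
    refine ⟨h.domain.add_mem hu hu', fun v => ?_⟩
    have : (⟨((u, f) + (u', f')).1, h.domain.add_mem hu hu'⟩ : h.domain) = ⟨u, hu⟩ + ⟨u', hu'⟩ :=
      rfl
    rw [this, map_add, LinearMap.add_apply, huf v, huf' v]
    simp
  smul_mem' := by
    rintro c ⟨u, f⟩ ⟨hu, huf⟩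
    refine ⟨h.domain.smul_mem c hu, fun v => ?_⟩
    have : (⟨(c • (u, f)).1, h.domain.smul_mem c hu⟩ : h.domain) = c • ⟨u, hu⟩ := rfl
    rw [this, map_smul, LinearMap.smul_apply, huf v]
    simp

/-- As the form is densely defined, its operator is single-valued. -/
theorem opGraph_snd_eq_zero (h : DenseForm H) (p : H × H) (hp : p ∈ h.opGraph) (h0 : p.1 = 0) :
    p.2 = 0 := by
  obtain ⟨u, f⟩ := p
  obtain ⟨hu, huf⟩ := hp
  simp only at h0
  subst h0
  refine h.dense.eq_zero_of_inner_right ℂ fun v hv => ?_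
  have h1 := huf ⟨v, hv⟩
  have : (⟨((0 : H), f).1, hu⟩ : h.domain) = 0 := rfl
  rw [this] at h1
  simpa using h1.symm

/-- The operator `A` associated with the form `h`:
`dom A ⊆ dom h` and `(A u, v) = h[u, v]` for `u ∈ dom A`, `v ∈ dom h`. -/
noncomputable def operator (h : DenseForm H) : H →ₗ.[ℂ] H := h.opGraph.toLinearPMap

theorem operator_graph (h : DenseForm H) : h.operator.graph = h.opGraph :=
  Submodule.toLinearPMap_graph_eq _ h.opGraph_snd_eq_zero

end DenseForm

end UnboundedOp

/-! ### Sobolev spaces on a bounded interval -/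

namespace IntervalSobolev

/-- The Hilbert space `L²(a, b)` of complex-valued functions. -/
abbrev L2 (a b : ℝ) : Type := Lp ℂ 2 (volume.restrict (Ioo a b))

/-- `φ ∈ C_c^∞(a, b)`. -/
structure IsTest (a b : ℝ) (φ : ℝ → ℂ) : Prop where
  contDiff : ContDiff ℝ ∞ φ
  hasCompactSupport : HasCompactSupport φ
  tsupport_subset : tsupport φ ⊆ Ioo a b

/-- `g` is the weak derivative of `u` on `(a, b)`. -/
def HasWeakDeriv {a b : ℝ} (u g : L2 a b) : Prop :=
  ∀ φ : ℝ → ℂ, IsTest a b φ →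
    ∫ x in Ioo a b, u x * deriv φ x = - ∫ x in Ioo a b, g x * φ x

variable {a b : ℝ}

namespace IsTest

theorem memLp {φ : ℝ → ℂ} (h : IsTest a b φ) : MemLp φ 2 (volume.restrict (Ioo a b)) :=
  (h.contDiff.continuous.memLp_of_hasCompactSupport h.hasCompactSupport).restrict _

theorem deriv {φ : ℝ → ℂ} (h : IsTest a b φ) : IsTest a b (deriv φ) where
  contDiff := ((contDiff_infty_iff_deriv (𝕜 := ℝ)).1 h.contDiff).2
  hasCompactSupport := h.hasCompactSupport.deriv
  tsupport_subset := (tsupport_deriv_subset (𝕜 := ℝ)).trans h.tsupport_subset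

theorem zero : IsTest a b 0 :=
  ⟨contDiff_const, HasCompactSupport.zero, by simp [tsupport]⟩

theorem add {φ ψ : ℝ → ℂ} (h : IsTest a b φ) (h' : IsTest a b ψ) : IsTest a b (φ + ψ) :=
  ⟨h.contDiff.add h'.contDiff, h.hasCompactSupport.add h'.hasCompactSupport,
    (tsupport_add φ ψ).trans (union_subset h.tsupport_subset h'.tsupport_subset)⟩

theorem smul {φ : ℝ → ℂ} (c : ℂ) (h : IsTest a b φ) : IsTest a b (c • φ) :=
  ⟨h.contDiff.const_smul c, h.hasCompactSupport.smul_left (f := fun _ => c),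
    (tsupport_smul_subset_right (fun _ => c) φ).trans h.tsupport_subset⟩

theorem ofReal {φ : ℝ → ℝ} (h : ContDiff ℝ ∞ φ) (hc : HasCompactSupport φ)
    (hs : tsupport φ ⊆ Ioo a b) : IsTest a b (fun x => (φ x : ℂ)) where
  contDiff := Complex.ofRealCLM.contDiff.comp h
  hasCompactSupport := hc.comp_left (g := fun x : ℝ => (x : ℂ)) Complex.ofReal_zero
  tsupport_subset :=
    (tsupport_comp_subset (g := fun x : ℝ => (x : ℂ)) Complex.ofReal_zero φ).trans hs

end IsTest

theorem integrable_mul_test (u : L2 a b) {φ : ℝ → ℂ} (h : IsTest a b φ) :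
    Integrable (fun x => u x * φ x) (volume.restrict (Ioo a b)) :=
  (Lp.memLp u).integrable_mul h.memLp

theorem integrable_coe (u : L2 a b) : Integrable (fun x => u x) (volume.restrict (Ioo a b)) :=
  (Lp.memLp u).integrable (by norm_num)

theorem HasWeakDeriv.add {u g u' g' : L2 a b} (h : HasWeakDeriv u g) (h' : HasWeakDeriv u' g') :
    HasWeakDeriv (u + u') (g + g') := by
  intro φ hφ
  have e1 : ∫ x in Ioo a b, (u + u') x * _root_.deriv φ x
      = ∫ x in Ioo a b, (u x * _root_.deriv φ x + u' x * _root_.deriv φ x) := by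
    refine integral_congr_ae ?_
    filter_upwards [Lp.coeFn_add u u'] with x hx
    rw [hx, Pi.add_apply, add_mul]
  have e2 : ∫ x in Ioo a b, (g + g') x * φ x
      = ∫ x in Ioo a b, (g x * φ x + g' x * φ x) := by
    refine integral_congr_ae ?_
    filter_upwards [Lp.coeFn_add g g'] with x hx
    rw [hx, Pi.add_apply, add_mul]
  rw [e1, e2, integral_add (integrable_mul_test u hφ.deriv) (integrable_mul_test u' hφ.deriv),
    integral_add (integrable_mul_test g hφ) (integrable_mul_test g' hφ), h φ hφ, h' φ hφ]
  ring

theorem HasWeakDeriv.smul {u g : L2 a b} (c : ℂ) (h : HasWeakDeriv u g) :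
    HasWeakDeriv (c • u) (c • g) := by
  intro φ hφ
  have e1 : ∫ x in Ioo a b, (c • u) x * _root_.deriv φ x
      = ∫ x in Ioo a b, c * (u x * _root_.deriv φ x) := by
    refine integral_congr_ae ?_
    filter_upwards [Lp.coeFn_smul c u] with x hx
    rw [hx, Pi.smul_apply, smul_eq_mul, mul_assoc]
  have e2 : ∫ x in Ioo a b, (c • g) x * φ x = ∫ x in Ioo a b, c * (g x * φ x) := by
    refine integral_congr_ae ?_
    filter_upwards [Lp.coeFn_smul c g] with x hx
    rw [hx, Pi.smul_apply, smul_eq_mul, mul_assoc]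
  rw [e1, e2, integral_const_mul, integral_const_mul, h φ hφ]
  ring

theorem HasWeakDeriv.zero : HasWeakDeriv (0 : L2 a b) 0 := by
  intro φ _
  have e (ψ : ℝ → ℂ) : ∫ x in Ioo a b, (0 : L2 a b) x * ψ x = 0 := by
    rw [← integral_zero ℝ ℂ (μ := volume.restrict (Ioo a b))]
    refine integral_congr_ae ?_
    filter_upwards [Lp.coeFn_zero ℂ 2 (volume.restrict (Ioo a b))] with x hx
    rw [hx]; simp
  rw [e, e, neg_zero]

/-- The fundamental lemma of the calculus of variations on `(a, b)`. -/
theorem ae_eq_zero_of_test {f : ℝ → ℂ} (hf : Integrable f (volume.restrict (Ioo a b)))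
    (h : ∀ φ : ℝ → ℂ, IsTest a b φ → ∫ x in Ioo a b, f x * φ x = 0) :
    f =ᵐ[volume.restrict (Ioo a b)] 0 := by
  have := isOpen_Ioo.ae_eq_zero_of_integral_contDiff_smul_eq_zero (μ := volume) (f := f)
    (U := Ioo a b) (IntegrableOn.locallyIntegrableOn hf) (by
      intro φ h1 h2 h3
      rw [← h _ (IsTest.ofReal h1 h2 h3), ← setIntegral_eq_integral_of_forall_compl_eq_zero
        (s := Ioo a b)]
      · refine integral_congr_ae (Eventually.of_forall fun x => ?_)
        simp [mul_comm]
      · intro x hx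
        rw [image_eq_zero_of_notMem_tsupport (fun hx' => hx (h3 hx')), zero_smul])
  exact (ae_restrict_iff' measurableSet_Ioo).2 this

theorem HasWeakDeriv.unique {u g g' : L2 a b} (h : HasWeakDeriv u g) (h' : HasWeakDeriv u g') :
    g = g' := by
  have key := ae_eq_zero_of_test ((integrable_coe g).sub (integrable_coe g')) (fun φ hφ => by
    have e : ∫ x in Ioo a b, ((fun x => g x) - fun x => g' x) x * φ x
        = ∫ x in Ioo a b, (g x * φ x - g' x * φ x) :=
      integral_congr_ae (Eventually.of_forall fun x => by simp [sub_mul])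
    rw [e, integral_sub (integrable_mul_test g hφ) (integrable_mul_test g' hφ)]
    have := (h φ hφ).symm.trans (h' φ hφ)
    rw [neg_inj.1 this, sub_self])
  refine Lp.ext ?_
  filter_upwards [key] with x hx
  exact sub_eq_zero.1 hx

/-- The Sobolev space `W^{1,2}(a, b)`: the `u ∈ L²(a, b)` with a weak derivative in `L²(a, b)`. -/
def W12 (a b : ℝ) : Submodule ℂ (L2 a b) where
  carrier := {u | ∃ g : L2 a b, HasWeakDeriv u g}
  zero_mem' := ⟨0, HasWeakDeriv.zero⟩
  add_mem' := by
    rintro u v ⟨g, hg⟩ ⟨k, hk⟩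
    exact ⟨g + k, hg.add hk⟩
  smul_mem' := by
    rintro c u ⟨g, hg⟩
    exact ⟨c • g, hg.smul c⟩

/-- The weak derivative `u ↦ u'` on `W^{1,2}(a, b)`. -/
noncomputable def weakDeriv (a b : ℝ) : W12 a b →ₗ[ℂ] L2 a b where
  toFun u := u.2.choose
  map_add' u v := (u + v).2.choose_spec.unique (u.2.choose_spec.add v.2.choose_spec)
  map_smul' c u := (c • u).2.choose_spec.unique (u.2.choose_spec.smul c)

theorem hasWeakDeriv_weakDeriv (u : W12 a b) : HasWeakDeriv (u : L2 a b) (weakDeriv a b u) :=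
  u.2.choose_spec

theorem IsTest.eq_zero {φ : ℝ → ℂ} (h : IsTest a b φ) {x : ℝ} (hx : x ∉ Ioo a b) : φ x = 0 :=
  image_eq_zero_of_notMem_tsupport fun hx' => hx (h.tsupport_subset hx')

/-- The primitive of a test function with vanishing integral is a test function. -/
theorem IsTest.primitive {θ : ℝ → ℂ} (hab : a < b) (h : IsTest a b θ)
    (h0 : ∫ x in Ioo a b, θ x = 0) :
    IsTest a b (fun x => ∫ t in a..x, θ t) ∧
      _root_.deriv (fun x => ∫ t in a..x, θ t) = θ := by
  have hc := h.contDiff.continuous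
  have hd : ∀ x, HasDerivAt (fun x => ∫ t in a..x, θ t) (θ x) x := fun x =>
    intervalIntegral.integral_hasDerivAt_right (hc.intervalIntegrable _ _)
      (hc.stronglyMeasurableAtFilter _ _) hc.continuousAt
  have hderiv : _root_.deriv (fun x => ∫ t in a..x, θ t) = θ := funext fun x => (hd x).deriv
  refine ⟨?_, hderiv⟩
  obtain ⟨a', b', ha', hb', hK⟩ : ∃ a' b', a < a' ∧ b' < b ∧ tsupport θ ⊆ Icc a' b' := by
    rcases (tsupport θ).eq_empty_or_nonempty with he | hne
    · exact ⟨a + 1, b - 1, by linarith, by linarith, by simp [he]⟩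
    · obtain ⟨m, hm, hm'⟩ := h.hasCompactSupport.isCompact.exists_isLeast hne
      obtain ⟨M, hM, hM'⟩ := h.hasCompactSupport.isCompact.exists_isGreatest hne
      exact ⟨m, M, (h.tsupport_subset hm).1, (h.tsupport_subset hM).2,
        fun x hx => ⟨hm' hx, hM' hx⟩⟩
  have hz : ∀ x, x ∉ Icc a' b' → θ x = 0 := fun x hx =>
    image_eq_zero_of_notMem_tsupport fun hx' => hx (hK hx')
  have h0' : ∫ t in a..b, θ t = 0 := by
    rw [intervalIntegral.integral_of_le hab.le, integral_Ioc_eq_integral_Ioo, h0]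
  have hsupp : Function.support (fun x => ∫ t in a..x, θ t) ⊆ Icc a' b' := by
    intro x hx
    by_contra hxK
    refine hx ?_
    rw [mem_Icc, not_and_or, not_le, not_le] at hxK
    rcases hxK with hxa | hxb
    · change ∫ t in a..x, θ t = 0
      rw [intervalIntegral.integral_congr (g := fun _ => (0 : ℂ))]
      · simp
      · intro t ht
        refine hz t fun ht' => ?_
        have := (mem_uIcc.1 ht)
        rcases this with h1 | h1 <;> linarith [ht'.1, h1.1, h1.2]
    · change ∫ t in a..x, θ t = 0
      rw [← intervalIntegral.integral_add_adjacent_intervals (hc.intervalIntegrable a b)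
        (hc.intervalIntegrable b x), h0', zero_add,
        intervalIntegral.integral_congr (g := fun _ => (0 : ℂ))]
      · simp
      · intro t ht
        refine hz t fun ht' => ?_
        have := (mem_uIcc.1 ht)
        rcases this with h1 | h1 <;> linarith [ht'.2, h1.1, h1.2]
  refine ⟨contDiff_infty_iff_deriv.2 ⟨fun x => (hd x).differentiableAt, by
      rw [hderiv]; exact h.contDiff⟩,
    HasCompactSupport.of_support_subset_isCompact isCompact_Icc hsupp, ?_⟩
  exact (closure_minimal hsupp isClosed_Icc).trans fun x hx =>
    ⟨ha'.trans_le hx.1, hx.2.trans_lt hb'⟩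

theorem exists_test_integral_one (hab : a < b) :
    ∃ ψ : ℝ → ℂ, IsTest a b ψ ∧ ∫ x in Ioo a b, ψ x = 1 := by
  let B : ContDiffBump ((a + b) / 2 : ℝ) := ⟨(b - a) / 8, (b - a) / 4, by linarith, by linarith⟩
  have hs : tsupport (B.normed volume) ⊆ Ioo a b := by
    rw [B.tsupport_normed_eq, Real.closedBall_eq_Icc]
    intro x hx
    change (a + b) / 2 - (b - a) / 4 ≤ x ∧ x ≤ (a + b) / 2 + (b - a) / 4 at hx
    constructor <;> linarith [hx.1, hx.2]
  have ht := IsTest.ofReal B.contDiff_normed B.hasCompactSupport_normed hs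
  refine ⟨_, ht, ?_⟩
  rw [setIntegral_eq_integral_of_forall_compl_eq_zero fun x hx => ht.eq_zero hx,
    integral_complex_ofReal, B.integral_normed]
  simp

/-- A function with vanishing weak derivative is constant. -/
theorem ae_eq_const_of_test (hab : a < b) {f : ℝ → ℂ}
    (hf : Integrable f (volume.restrict (Ioo a b)))
    (h : ∀ φ : ℝ → ℂ, IsTest a b φ → ∫ x in Ioo a b, f x * deriv φ x = 0) :
    ∃ c : ℂ, f =ᵐ[volume.restrict (Ioo a b)] fun _ => c := by
  obtain ⟨ψ, hψ, hψ1⟩ := exists_test_integral_one hab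
  have hint : ∀ {φ : ℝ → ℂ}, IsTest a b φ →
      Integrable φ (volume.restrict (Ioo a b)) := fun hφ => hφ.memLp.integrable (by norm_num)
  have hfi : ∀ {φ : ℝ → ℂ}, IsTest a b φ →
      Integrable (fun x => f x * φ x) (volume.restrict (Ioo a b)) := by
    intro φ hφ
    obtain ⟨C, hC⟩ := hφ.contDiff.continuous.bounded_above_of_compact_support
      hφ.hasCompactSupport
    exact hf.mul_bdd (c := C) hφ.contDiff.continuous.aestronglyMeasurable (Eventually.of_forall hC)
  set c := ∫ x in Ioo a b, f x * ψ x with hc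
  refine ⟨c, ?_⟩
  have key := ae_eq_zero_of_test (f := fun x => f x - c) (hf.sub (integrable_const c)) (fun φ hφ => by
    set I := ∫ x in Ioo a b, φ x with hI
    have hθ : IsTest a b (φ + (-I) • ψ) := hφ.add (hψ.smul _)
    have hθ0 : ∫ x in Ioo a b, (φ + (-I) • ψ) x = 0 := by
      simp only [Pi.add_apply, Pi.smul_apply, smul_eq_mul]
      rw [integral_add (hint hφ) ((hint hψ).const_mul _), integral_const_mul, hψ1]
      simp [hI]
    obtain ⟨hΦ, hΦ'⟩ := hθ.primitive hab hθ0
    have h1 := h _ hΦ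
    rw [hΦ'] at h1
    have e1 : ∫ x in Ioo a b, f x * (φ + (-I) • ψ) x
        = (∫ x in Ioo a b, f x * φ x) + (-I) * c := by
      rw [hc, ← integral_const_mul, ← integral_add (hfi hφ) ((hfi hψ).const_mul _)]
      refine integral_congr_ae (Eventually.of_forall fun x => ?_)
      simp only [Pi.add_apply, Pi.smul_apply, smul_eq_mul]
      ring
    have e2 : ∫ x in Ioo a b, (f x - c) * φ x
        = (∫ x in Ioo a b, f x * φ x) - c * I := by
      rw [hI, ← integral_const_mul, ← integral_sub (hfi hφ) ((hint hφ).const_mul _)]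
      refine integral_congr_ae (Eventually.of_forall fun x => ?_)
      ring
    rw [e2]
    rw [e1] at h1
    linear_combination h1)
  filter_upwards [key] with x hx
  exact sub_eq_zero.1 hx

/-- The primitive of `g` has weak derivative `g`. -/
theorem integral_primitive_mul_deriv {g : ℝ → ℂ}
    (hg : Integrable g (volume.restrict (Ioo a b))) {φ : ℝ → ℂ} (hφ : IsTest a b φ) :
    ∫ x in Ioo a b, (∫ t in a..x, g t) * deriv φ x = - ∫ x in Ioo a b, g x * φ x := by
  have hφi : Integrable (deriv φ) (volume.restrict (Ioo a b)) :=
    hφ.deriv.memLp.integrable (by norm_num)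
  set F : ℝ × ℝ → ℂ := {p : ℝ × ℝ | p.2 < p.1}.indicator fun p => deriv φ p.1 * g p.2 with hF
  have hFi : Integrable F ((volume.restrict (Ioo a b)).prod (volume.restrict (Ioo a b))) :=
    (hφi.mul_prod hg).indicator (measurableSet_lt measurable_snd measurable_fst)
  have e1 : ∫ x in Ioo a b, (∫ t in a..x, g t) * deriv φ x
      = ∫ x in Ioo a b, ∫ t in Ioo a b, F (x, t) := by
    refine setIntegral_congr_fun measurableSet_Ioo fun x hx => ?_
    have : ∀ t, F (x, t) = (Iio x).indicator (fun t => deriv φ x * g t) t := fun t => rfl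
    simp only [this]
    rw [setIntegral_indicator measurableSet_Iio, Ioo_inter_Iio, min_eq_right hx.2.le,
      integral_const_mul, intervalIntegral.integral_of_le hx.1.le, integral_Ioc_eq_integral_Ioo,
      mul_comm]
  have e2 : ∫ t in Ioo a b, ∫ x in Ioo a b, F (x, t) = ∫ t in Ioo a b, -(g t * φ t) := by
    refine setIntegral_congr_fun measurableSet_Ioo fun t ht => ?_
    have : ∀ x, F (x, t) = (Ioi t).indicator (fun x => deriv φ x * g t) x := fun x => rfl
    simp only [this]
    rw [setIntegral_indicator measurableSet_Ioi, Ioo_inter_Ioi, max_eq_right ht.1.le,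
      integral_mul_const, ← integral_Ioc_eq_integral_Ioo,
      ← intervalIntegral.integral_of_le ht.2.le,
      intervalIntegral.integral_deriv_eq_sub (fun x _ => (hφ.contDiff.differentiable
        (by simp)).differentiableAt) (hφ.deriv.contDiff.continuous.intervalIntegrable _ _),
      hφ.eq_zero (x := b) (by simp)]
    ring
  rw [e1, integral_integral_swap (f := fun x t => F (x, t)) hFi, e2, integral_neg]

/-- The embedding `W^{1,2}(a, b) ⊂ C([a, b])`. -/
theorem exists_continuous_rep (hab : a < b) (u : W12 a b) :
    ∃ w : ℝ → ℂ, ContinuousOn w (Icc a b) ∧ (u : L2 a b) =ᵐ[volume.restrict (Ioo a b)] w := by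
  set g := weakDeriv a b u with hgdef
  have hu := hasWeakDeriv_weakDeriv u
  have hg : IntegrableOn (fun x => g x) (Icc a b) :=
    (integrableOn_Icc_iff_integrableOn_Ioo (by finiteness) (by finiteness)).2 (integrable_coe g)
  have hG : ContinuousOn (fun x => ∫ t in a..x, g t) (Icc a b) :=
    intervalIntegral.continuousOn_primitive_interval (by rwa [uIcc_of_le hab.le]) |>.mono
      (by rw [uIcc_of_le hab.le])
  have hGi : Integrable (fun x => ∫ t in a..x, g t) (volume.restrict (Ioo a b)) :=
    (hG.integrableOn_Icc).mono_set Ioo_subset_Icc_self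
  obtain ⟨c, hc⟩ := ae_eq_const_of_test hab ((integrable_coe (u : L2 a b)).sub hGi)
    (fun φ hφ => by
      obtain ⟨C, hC⟩ := hφ.deriv.contDiff.continuous.bounded_above_of_compact_support
        hφ.deriv.hasCompactSupport
      have i2 := hGi.mul_bdd (c := C) (hφ.deriv.contDiff.continuous.aestronglyMeasurable)
        (Eventually.of_forall hC)
      have e : ∫ x in Ioo a b,
          ((fun x => (u : L2 a b) x) - fun x => ∫ t in a..x, g t) x * deriv φ x
          = ∫ x in Ioo a b, ((u : L2 a b) x * deriv φ x - (∫ t in a..x, g t) * deriv φ x) :=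
        integral_congr_ae (Eventually.of_forall fun x => by simp [sub_mul])
      rw [e, integral_sub (integrable_mul_test _ hφ.deriv) i2, hu φ hφ,
        integral_primitive_mul_deriv (integrable_coe g) hφ, sub_self])
  refine ⟨fun x => (∫ t in a..x, g t) + c, hG.add continuousOn_const, ?_⟩
  filter_upwards [hc] with x hx
  rw [← hx]
  simp

theorem eqOn_of_ae_eq (hab : a < b) {w w' : ℝ → ℂ} (h : ContinuousOn w (Icc a b))
    (h' : ContinuousOn w' (Icc a b)) (he : w =ᵐ[volume.restrict (Ioo a b)] w') :
    EqOn w w' (Icc a b) := by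
  refine Measure.eqOn_Icc_of_ae_eq (μ := volume) hab.ne ?_ h h'
  rwa [restrict_Ioo_eq_restrict_Icc] at he

/-- The value `u(x)`, `x ∈ [a, b]`, of `u ∈ W^{1,2}(a, b)`, that is, of the continuous
representative of `u`. -/
noncomputable def eval (hab : a < b) (x : ℝ) (hx : x ∈ Icc a b) : W12 a b →ₗ[ℂ] ℂ where
  toFun u := (exists_continuous_rep hab u).choose x
  map_add' u v := by
    have hu := (exists_continuous_rep hab u).choose_spec
    have hv := (exists_continuous_rep hab v).choose_spec
    have huv := (exists_continuous_rep hab (u + v)).choose_spec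
    refine eqOn_of_ae_eq hab huv.1 (hu.1.add hv.1) ?_ hx
    filter_upwards [hu.2, hv.2, huv.2, Lp.coeFn_add (u : L2 a b) v] with x h1 h2 h3 h4
    rw [← h3, Pi.add_apply, ← h1, ← h2]
    exact h4
  map_smul' c u := by
    have hu := (exists_continuous_rep hab u).choose_spec
    have hcu := (exists_continuous_rep hab (c • u)).choose_spec
    refine eqOn_of_ae_eq hab hcu.1 (hu.1.const_smul c) ?_ hx
    filter_upwards [hu.2, hcu.2, Lp.coeFn_smul c (u : L2 a b)] with x h1 h2 h3
    rw [← h2, Pi.smul_apply, ← h1]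
    exact h3

theorem eval_eq (hab : a < b) {x : ℝ} (hx : x ∈ Icc a b) (u : W12 a b) {w : ℝ → ℂ}
    (hw : ContinuousOn w (Icc a b)) (hu : (u : L2 a b) =ᵐ[volume.restrict (Ioo a b)] w) :
    eval hab x hx u = w x :=
  have h := (exists_continuous_rep hab u).choose_spec
  eqOn_of_ae_eq hab h.1 hw (h.2.symm.trans hu) hx

/-- `C_c^∞(a, b)` as a subspace of `L²(a, b)`. -/
def testSpace (a b : ℝ) : Submodule ℂ (L2 a b) where
  carrier := {u | ∃ φ : ℝ → ℂ, IsTest a b φ ∧ u =ᵐ[volume.restrict (Ioo a b)] φ}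
  zero_mem' := ⟨0, IsTest.zero, Lp.coeFn_zero _ _ _⟩
  add_mem' := by
    rintro u v ⟨φ, hφ, hu⟩ ⟨ψ, hψ, hv⟩
    exact ⟨φ + ψ, hφ.add hψ, (Lp.coeFn_add u v).trans (hu.add hv)⟩
  smul_mem' := by
    rintro c u ⟨φ, hφ, hu⟩
    exact ⟨c • φ, hφ.smul c, (Lp.coeFn_smul c u).trans (hu.const_smul c)⟩

theorem testSpace_le_W12 : testSpace a b ≤ W12 a b := by
  rintro u ⟨φ, hφ, hu⟩
  refine ⟨hφ.deriv.memLp.toLp _, fun χ hχ => ?_⟩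
  have e1 : ∫ x in Ioo a b, u x * deriv χ x = ∫ x, φ x * deriv χ x := by
    rw [← setIntegral_eq_integral_of_forall_compl_eq_zero (s := Ioo a b)
      (f := fun x => φ x * deriv χ x) fun x hx => by rw [hφ.eq_zero hx, zero_mul]]
    refine integral_congr_ae ?_
    filter_upwards [hu] with x hx
    rw [hx]
  have e2 : ∫ x in Ioo a b, (hφ.deriv.memLp.toLp _ : L2 a b) x * χ x
      = ∫ x, deriv φ x * χ x := by
    rw [← setIntegral_eq_integral_of_forall_compl_eq_zero (s := Ioo a b)
      (f := fun x => deriv φ x * χ x) fun x hx => by rw [hχ.eq_zero hx, mul_zero]]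
    refine integral_congr_ae ?_
    filter_upwards [hφ.deriv.memLp.coeFn_toLp] with x hx
    rw [hx]
  have hd : ∀ {ψ : ℝ → ℂ}, IsTest a b ψ → ∀ x, HasDerivAt ψ (deriv ψ x) x := fun hψ x =>
    (hψ.contDiff.differentiable (by simp)).differentiableAt.hasDerivAt
  rw [e1, e2]
  refine integral_mul_deriv_eq_deriv_mul_of_integrable (fun x _ => hd hφ x) (fun x _ => hd hχ x) ?_ ?_ ?_
  · exact (hφ.contDiff.continuous.mul hχ.deriv.contDiff.continuous).integrable_of_hasCompactSupport
      hφ.hasCompactSupport.mul_right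
  · exact (hφ.deriv.contDiff.continuous.mul hχ.contDiff.continuous).integrable_of_hasCompactSupport
      hχ.hasCompactSupport.mul_left
  · exact (hφ.contDiff.continuous.mul hχ.contDiff.continuous).integrable_of_hasCompactSupport
      hφ.hasCompactSupport.mul_right

theorem dense_testSpace : Dense (testSpace a b : Set (L2 a b)) := by
  rw [Submodule.dense_iff_topologicalClosure_eq_top, Submodule.topologicalClosure_eq_top_iff,
    Submodule.eq_bot_iff]
  intro f hf
  have key := ae_eq_zero_of_test (integrable_coe f) (fun φ hφ => by
    have hφ' : IsTest a b (fun x => (starRingEnd ℂ) (φ x)) := by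
      refine ⟨Complex.conjCLE.contDiff.comp hφ.contDiff, ?_, ?_⟩
      · exact hφ.hasCompactSupport.comp_left (map_zero (starRingEnd ℂ))
      · exact (tsupport_comp_subset (map_zero (starRingEnd ℂ)) φ).trans hφ.tsupport_subset
    have h1 := (Submodule.mem_orthogonal _ _).1 hf (hφ'.memLp.toLp _)
      ⟨_, hφ', hφ'.memLp.coeFn_toLp⟩
    rw [L2.inner_def] at h1
    rw [← h1]
    refine integral_congr_ae ?_
    filter_upwards [hφ'.memLp.coeFn_toLp] with x hx
    rw [hx]
    simp [RCLike.inner_apply])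
  exact Lp.ext (key.trans (Lp.coeFn_zero _ _ _).symm)

/-- `u ↦ (u, u')`, which induces the topology of `W^{1,2}(a, b)`. -/
noncomputable def jet (a b : ℝ) : W12 a b →ₗ[ℂ] L2 a b × L2 a b :=
  (W12 a b).subtype.prod (weakDeriv a b)

/-- `W_0^{1,2}(a, b)`: the closure of `C_c^∞(a, b)` in `W^{1,2}(a, b)`. -/
noncomputable def W120 (a b : ℝ) : Submodule ℂ (L2 a b) :=
  Submodule.map (W12 a b).subtype <| Submodule.comap (jet a b) <| Submodule.topologicalClosure <|
    Submodule.map (jet a b) <| Submodule.comap (W12 a b).subtype (testSpace a b)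

theorem W120_le_W12 : W120 a b ≤ W12 a b := Submodule.map_subtype_le _ _

theorem testSpace_le_W120 : testSpace a b ≤ W120 a b := fun u hu =>
  ⟨⟨u, testSpace_le_W12 hu⟩, Submodule.le_topologicalClosure _ ⟨⟨u, testSpace_le_W12 hu⟩, hu, rfl⟩,
    rfl⟩

end IntervalSobolev

/-! ### A single δ-interaction on a bounded interval -/

namespace DeltaInteraction

open UnboundedOp IntervalSobolev

variable {xm xp : ℝ}

theorem left_mem (hx : xm < xp) : xm ∈ Icc xm xp := left_mem_Icc.2 hx.le

theorem right_mem (hx : xm < xp) : xp ∈ Icc xm xp := right_mem_Icc.2 hx.le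

theorem mid_mem (hx : xm < xp) : (xm + xp) / 2 ∈ Icc xm xp := ⟨by linarith, by linarith⟩

/-- The expression `(u', v')_{L²} + α u(y) conj v(y)` on `W^{1,2}(x₋, x₊)`. -/
noncomputable def deltaExpr (hx : xm < xp) (α : ℝ) :
    W12 xm xp →ₗ[ℂ] W12 xm xp →ₛₗ[starRingEnd ℂ] ℂ :=
  LinearMap.mk₂'ₛₗ (RingHom.id ℂ) (starRingEnd ℂ)
    (fun u v => inner ℂ (weakDeriv xm xp v) (weakDeriv xm xp u)
      + α * (eval hx _ (mid_mem hx) u * starRingEnd ℂ (eval hx _ (mid_mem hx) v)))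
    (fun u u' v => by simp only [map_add, inner_add_right]; ring)
    (fun c u v => by simp only [map_smul, inner_smul_right, smul_eq_mul, RingHom.id_apply]; ring)
    (fun u v v' => by simp only [map_add, inner_add_left]; ring)
    (fun c u v => by simp only [map_smul, inner_smul_left, smul_eq_mul, map_mul]; ring)

/-- The expression
`(u', v')_{L²} + α u(y) conj v(y) + ½ (β₋ u(x₋) conj v(x₋) + β₊ u(x₊) conj v(x₊))`
on `W^{1,2}(x₋, x₊)`, where `y` is the midpoint. -/
noncomputable def robinExpr (hx : xm < xp) (α βm βp : ℝ) :
    W12 xm xp →ₗ[ℂ] W12 xm xp →ₛₗ[starRingEnd ℂ] ℂ :=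
  LinearMap.mk₂'ₛₗ (RingHom.id ℂ) (starRingEnd ℂ)
    (fun u v => deltaExpr hx α u v
      + 1 / 2 * (βm * (eval hx xm (left_mem hx) u * starRingEnd ℂ (eval hx xm (left_mem hx) v))
        + βp * (eval hx xp (right_mem hx) u * starRingEnd ℂ (eval hx xp (right_mem hx) v))))
    (fun u u' v => by simp only [map_add, LinearMap.add_apply]; ring)
    (fun c u v => by simp only [map_smul, LinearMap.smul_apply, smul_eq_mul, RingHom.id_apply]; ring)
    (fun u v v' => by simp only [map_add]; ring)
    (fun c u v => by simp only [map_smul, map_smulₛₗ, smul_eq_mul, map_mul]; ring)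

/-- The form with Dirichlet boundary conditions, with domain `W_0^{1,2}(x₋, x₊)`. -/
noncomputable def dirichletForm (hx : xm < xp) (α : ℝ) : DenseForm (L2 xm xp) where
  domain := W120 xm xp
  form := LinearMap.mk₂'ₛₗ (RingHom.id ℂ) (starRingEnd ℂ)
    (fun u v => deltaExpr hx α (Submodule.inclusion W120_le_W12 u)
      (Submodule.inclusion W120_le_W12 v))
    (fun u u' v => by simp only [map_add, LinearMap.add_apply])
    (fun c u v => by simp only [map_smul, LinearMap.smul_apply, RingHom.id_apply])
    (fun u v v' => by simp only [map_add])
    (fun c u v => by simp only [map_smul, map_smulₛₗ])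
  dense := dense_testSpace.mono testSpace_le_W120

/-- The form with Robin boundary conditions, with domain `W^{1,2}(x₋, x₊)`. -/
noncomputable def robinForm (hx : xm < xp) (α βm βp : ℝ) : DenseForm (L2 xm xp) where
  domain := W12 xm xp
  form := robinExpr hx α βm βp
  dense := dense_testSpace.mono testSpace_le_W12

/-- The operator `-d²/dx² + α δ_y` on `(x₋, x₊)` with Dirichlet boundary conditions. -/
noncomputable def dirichletOp (hx : xm < xp) (α : ℝ) : L2 xm xp →ₗ.[ℂ] L2 xm xp :=
  (dirichletForm hx α).operator

/-- The operator `-d²/dx² + α δ_y` on `(x₋, x₊)` with the boundary conditions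
`u'(x₋) = ½ β₋ u(x₋)`, `u'(x₊) = -½ β₊ u(x₊)`. -/
noncomputable def robinOp (hx : xm < xp) (α βm βp : ℝ) : L2 xm xp →ₗ.[ℂ] L2 xm xp :=
  (robinForm hx α βm βp).operator

end DeltaInteraction

/-!
The Sobolev space, identified with the graph of `u ↦ u'` in `L² ⊕ L²`, is a Hilbert space which is
compactly embedded in `L²`. By the Lax-Milgram theorem, a bounded symmetric form on it which is
coercive up to a multiple of the `L²` norm has a compact resolvent. The spectral theorem for compact
self-adjoint operators then gives a purely discrete spectrum, and the min-max principle says that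
the `j`-th eigenvalue is the infimum of those `t` for which the form is at most `t ‖u‖²` on some
`j`-dimensional subspace.

Every Dirichlet trial space is a Robin trial space with the same bound, so the Robin eigenvalues are
at most the Dirichlet ones. Conversely, if `min β₋ β₊` is large, then a bound on the Robin form
forces the boundary values of a trial function to be small. Subtracting a fixed extension of these
boundary values turns a Robin trial space into a Dirichlet one with nearly the same bound.
-/

namespace UnboundedOp

variable {H : Type*} [NormedAddCommGroup H] [InnerProductSpace ℂ H]

theorem re_inner_self (u : H) : (inner ℂ u u).re = ‖u‖ ^ 2 :=
  inner_self_eq_norm_sq (𝕜 := ℂ) u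

theorem isUnit_of_le_re_inner [CompleteSpace H] (T : H →L[ℂ] H) {a : ℝ} (ha : 0 < a)
    (hT : ∀ u, a * ‖u‖ ^ 2 ≤ (inner ℂ u (T u)).re) : IsUnit T := by
  refine T.isUnit_of_forall_le_norm_inner_map (c := ⟨a, ha.le⟩) ha fun u => ?_
  calc ‖u‖ ^ 2 * a ≤ (inner ℂ u (T u)).re := by rw [mul_comm]; exact hT u
    _ ≤ ‖inner ℂ u (T u)‖ := Complex.re_le_norm _
    _ = ‖inner ℂ (T u) u‖ := by rw [← inner_conj_symm, RCLike.norm_conj]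

theorem finiteDimensional_of_isUnit_of_isCompactOperator {T : H →L[ℂ] H}
    (hT : IsUnit T) (hc : IsCompactOperator T) : FiniteDimensional ℂ H := by
  obtain ⟨W, rfl⟩ := hT
  have hid : (↑W⁻¹ : H →L[ℂ] H) ∘ (W : H →L[ℂ] H) = id :=
    funext fun u => DFunLike.congr_fun W.inv_mul u
  have hcomp := hc.clm_comp (↑W⁻¹ : H →L[ℂ] H)
  rw [hid] at hcomp
  exact FiniteDimensional.of_isCompactOperator_id hcomp

theorem finiteDimensional_of_isCompactOperator_of_le_re_inner [CompleteSpace H] {K : H →L[ℂ] H}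
    (hK : IsCompactOperator K) {N : Submodule ℂ H} (hN : ∀ u ∈ N, K u ∈ N) {a : ℝ} (ha : 0 < a)
    (hle : ∀ u ∈ N, a * ‖u‖ ^ 2 ≤ (inner ℂ u (K u)).re) : FiniteDimensional ℂ N := by
  have hM : ∀ u ∈ N.topologicalClosure, K u ∈ N.topologicalClosure := fun u hu =>
    map_mem_closure K.continuous hu hN
  have hle' : ∀ u ∈ N.topologicalClosure, a * ‖u‖ ^ 2 ≤ (inner ℂ u (K u)).re := fun u hu =>
    closure_minimal hle
      (isClosed_le (by fun_prop) (Complex.continuous_re.comp (by fun_prop))) hu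
  have : CompleteSpace N.topologicalClosure := N.isClosed_topologicalClosure.completeSpace_coe
  have : FiniteDimensional ℂ N.topologicalClosure :=
    finiteDimensional_of_isUnit_of_isCompactOperator
      (isUnit_of_le_re_inner (K.restrict hM) ha fun u => hle' u u.2) (hK.restrict' hM)
  exact Submodule.finiteDimensional_of_le N.le_topologicalClosure

theorem re_inner_sum_smul {ι : Type*} {V : ι → Submodule ℂ H}
    (hV : OrthogonalFamily ℂ (fun i => V i) fun i => (V i).subtypeₗᵢ) (s : Finset ι)
    (v : ∀ i, V i) (m : ι → ℝ) :
    (inner ℂ (∑ i ∈ s, (v i : H)) (∑ i ∈ s, (m i : ℂ) • (v i : H))).re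
      = ∑ i ∈ s, m i * ‖v i‖ ^ 2 := by
  have h := hV.inner_sum v (fun i => (m i : ℂ) • v i) s
  simp only [Submodule.coe_subtypeₗᵢ, Submodule.subtype_apply, Submodule.coe_smul] at h
  rw [h, Complex.re_sum]
  exact Finset.sum_congr rfl fun i _ => by
    rw [inner_smul_right, Complex.re_ofReal_mul, re_inner_self]

theorem norm_sq_sum {ι : Type*} {V : ι → Submodule ℂ H}
    (hV : OrthogonalFamily ℂ (fun i => V i) fun i => (V i).subtypeₗᵢ) (s : Finset ι)
    (v : ∀ i, V i) : ‖∑ i ∈ s, (v i : H)‖ ^ 2 = ∑ i ∈ s, ‖v i‖ ^ 2 :=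
  hV.norm_sum v s

/-! ### The shifted energy of a sesquilinear form -/

section ShiftedEnergy

variable {D : Submodule ℂ H} {B : D →ₗ[ℂ] D →ₛₗ[starRingEnd ℂ] ℂ} {c : ℝ}

/-- The quadratic form `re B[u, u] + c ‖u‖²` of the form `B + c`. The zero form with `c = 1` gives
the squared norm of the ambient space, to which the estimates for quadratic forms thus apply. -/
noncomputable def shiftedEnergy (B : D →ₗ[ℂ] D →ₛₗ[starRingEnd ℂ] ℂ) (c : ℝ) (u : D) : ℝ :=
  (B u u).re + c * ‖(u : H)‖ ^ 2

theorem shiftedEnergy_zero_one (u : D) :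
    shiftedEnergy (0 : D →ₗ[ℂ] D →ₛₗ[starRingEnd ℂ] ℂ) 1 u = ‖(u : H)‖ ^ 2 := by
  simp [shiftedEnergy]

theorem shiftedEnergy_eq_re (u : D) :
    shiftedEnergy B c u = (B u u + c * inner ℂ (u : H) (u : H)).re := by
  rw [shiftedEnergy, Complex.add_re, Complex.re_ofReal_mul, re_inner_self]

theorem shiftedEnergy_smul (z : ℂ) (u : D) :
    shiftedEnergy B c (z • u) = ‖z‖ ^ 2 * shiftedEnergy B c u := by
  have hB : B (z • u) (z • u) = ((‖z‖ ^ 2 : ℝ) : ℂ) * B u u := by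
    rw [map_smulₛₗ, map_smul, LinearMap.smul_apply, smul_eq_mul, smul_eq_mul, ← mul_assoc,
      Complex.conj_mul', ← Complex.ofReal_pow]
  rw [shiftedEnergy, shiftedEnergy, hB, Complex.re_ofReal_mul, Submodule.coe_smul, norm_smul]
  ring

theorem shiftedEnergy_add_smul (u v : D) (r : ℝ) :
    shiftedEnergy B c (u + (r : ℂ) • v) = shiftedEnergy B c u
      + r * ((B u v).re + (B v u).re + 2 * c * (inner ℂ (u : H) (v : H)).re)
      + r ^ 2 * shiftedEnergy B c v := by
  have hB : B (u + (r : ℂ) • v) (u + (r : ℂ) • v)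
      = B u u + r * (B u v + B v u) + ((r ^ 2 : ℝ) : ℂ) * B v v := by
    simp only [map_add, map_smul, map_smulₛₗ, LinearMap.add_apply, LinearMap.smul_apply,
      smul_eq_mul, Complex.conj_ofReal, Complex.ofReal_pow]
    ring
  have hn : ‖((u + (r : ℂ) • v : D) : H)‖ ^ 2
      = ‖(u : H)‖ ^ 2 + 2 * (r * (inner ℂ (u : H) (v : H)).re) + r ^ 2 * ‖(v : H)‖ ^ 2 := by
    rw [Submodule.coe_add, Submodule.coe_smul, norm_add_sq (𝕜 := ℂ), inner_smul_right,
      norm_smul, mul_pow, Complex.norm_real, Real.norm_eq_abs, sq_abs]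
    congr 3
    exact Complex.re_ofReal_mul _ _
  simp only [shiftedEnergy, hB, hn, Complex.add_re, Complex.re_ofReal_mul]
  ring

/-- Young's inequality, from `0 ≤ E (δ u - v)` for the shifted energy `E`. -/
theorem shiftedEnergy_add_le (hE : ∀ u, 0 ≤ shiftedEnergy B c u) {δ : ℝ} (hδ : 0 < δ) (u v : D) :
    shiftedEnergy B c (u + v)
      ≤ (1 + δ) * shiftedEnergy B c u + (1 + δ⁻¹) * shiftedEnergy B c v := by
  have hadd := shiftedEnergy_add_smul (B := B) (c := c) u v 1
  have hsub := shiftedEnergy_add_smul (B := B) (c := c) u v (-δ⁻¹)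
  have hnn := mul_nonneg hδ.le (hE (u + ((-δ⁻¹ : ℝ) : ℂ) • v))
  rw [hsub] at hnn
  rw [Complex.ofReal_one, one_smul] at hadd
  rw [hadd]
  field_simp at hnn ⊢
  linarith

theorem shiftedEnergy_sub_le (hE : ∀ u, 0 ≤ shiftedEnergy B c u) {δ : ℝ} (hδ : 0 < δ) (u v : D) :
    shiftedEnergy B c (u - v)
      ≤ (1 + δ) * shiftedEnergy B c u + (1 + δ⁻¹) * shiftedEnergy B c v := by
  have h := shiftedEnergy_add_le hE hδ u ((-1 : ℂ) • v)
  rwa [shiftedEnergy_smul, norm_neg, norm_one, one_pow, one_mul, neg_one_smul,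
    ← sub_eq_add_neg] at h

theorem shiftedEnergy_smul_add_smul_le (hE : ∀ u, 0 ≤ shiftedEnergy B c u) (z w : ℂ) (u v : D) :
    shiftedEnergy B c (z • u + w • v)
      ≤ 2 * (shiftedEnergy B c u + shiftedEnergy B c v) * (‖z‖ ^ 2 + ‖w‖ ^ 2) := by
  have h := shiftedEnergy_add_le hE one_pos (z • u) (w • v)
  rw [shiftedEnergy_smul, shiftedEnergy_smul] at h
  have huw := mul_nonneg (hE u) (sq_nonneg ‖w‖)
  have hvz := mul_nonneg (hE v) (sq_nonneg ‖z‖)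
  linarith

end ShiftedEnergy

/-! ### Eigenvalues, spectrum and trial values -/

theorem mem_resolventSet_of_mem_graph_iff {A : H →ₗ.[ℂ] H} {z : ℂ} (R : H →L[ℂ] H)
    (hR : ∀ u f, (u, f) ∈ A.graph ↔ u = R (f - z • u)) : z ∈ resolventSet A := by
  refine ⟨R, fun f => ?_, fun u => ((hR u (A u)).1 (A.mem_graph u)).symm⟩
  obtain ⟨y, hy, hAy⟩ := A.mem_graph_iff.1
    ((hR (R f) (f + z • R f)).2 (by rw [add_sub_cancel_right]))
  simp only at hy hAy
  refine ⟨hy ▸ y.2, ?_⟩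
  simp only [← hy, Subtype.coe_eta, hAy, add_sub_cancel_right]

theorem mem_spectrum_of_eigenspace_ne_bot {A : H →ₗ.[ℂ] H} {z : ℂ} (hz : eigenspace A z ≠ ⊥) :
    z ∈ spectrum A := by
  rintro ⟨R, -, hR⟩
  obtain ⟨u, hu, hu0⟩ := Submodule.exists_mem_ne_zero_of_ne_bot hz
  obtain ⟨hm, hA⟩ := mem_eigenspace.1 hu
  have hRu := hR ⟨u, hm⟩
  rw [hA, sub_self, map_zero] at hRu
  exact hu0 hRu.symm

/-- The span of the eigenspaces of `A` for the eigenvalues `≤ t`: the range of the spectral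
projection of `A` for `(-∞, t]`, if `A` is self-adjoint with purely discrete spectrum. -/
def spectralSubspace (A : H →ₗ.[ℂ] H) (t : ℝ) : Submodule ℂ H :=
  ⨆ μ : ℝ, ⨆ _ : μ ≤ t, eigenspace A (μ : ℂ)

theorem eigenspace_le_spectralSubspace (A : H →ₗ.[ℂ] H) {μ t : ℝ} (h : μ ≤ t) :
    eigenspace A (μ : ℂ) ≤ spectralSubspace A t :=
  le_iSup₂_of_le μ h le_rfl

namespace DenseForm

theorem mem_operator_graph {h : DenseForm H} {u f : H} :
    (u, f) ∈ h.operator.graph ↔ ∃ hu : u ∈ h.domain, ∀ v : h.domain,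
      h.form ⟨u, hu⟩ v = inner ℂ (v : H) f := by
  rw [operator_graph]; rfl

/-- The values `t` for which there is a `j`-dimensional subspace of the form domain on which the
form is bounded by `t`; by the min-max principle the `j`-th eigenvalue is their infimum. -/
def trialValues (h : DenseForm H) (j : ℕ) : Set ℝ :=
  {t | ∃ f : (Fin j → ℂ) →ₗ[ℂ] h.domain, Function.Injective f ∧
    ∀ x, (h.form (f x) (f x)).re ≤ t * ‖(f x : H)‖ ^ 2}

theorem mem_trialValues_of_map {h k : DenseForm H} (P : h.domain →ₗ[ℂ] k.domain) {s t : ℝ}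
    (hinj : ∀ u, (h.form u u).re ≤ t * ‖(u : H)‖ ^ 2 → P u = 0 → u = 0)
    (hle : ∀ u, (h.form u u).re ≤ t * ‖(u : H)‖ ^ 2 →
      (k.form (P u) (P u)).re ≤ s * ‖(P u : H)‖ ^ 2)
    {j : ℕ} (ht : t ∈ h.trialValues j) : s ∈ k.trialValues j := by
  obtain ⟨f, hf, hft⟩ := ht
  refine ⟨P ∘ₗ f, ?_, fun x => hle (f x) (hft x)⟩
  rw [injective_iff_map_eq_zero]
  exact fun x hx => (map_eq_zero_iff f hf).1 (hinj (f x) (hft x) hx)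

theorem neg_le_of_mem_trialValues {h : DenseForm H} {c : ℝ}
    (hc : ∀ u, 0 ≤ shiftedEnergy h.form c u) {j : ℕ} (hj : 1 ≤ j) {t : ℝ}
    (ht : t ∈ h.trialValues j) : -c ≤ t := by
  obtain ⟨f, hf, hft⟩ := ht
  have : Nonempty (Fin j) := ⟨⟨0, hj⟩⟩
  obtain ⟨x, hx⟩ := exists_ne (0 : Fin j → ℂ)
  have hfx : (f x : H) ≠ 0 := by simpa [map_eq_zero_iff f hf] using hx
  have hpos : 0 < ‖(f x : H)‖ ^ 2 := by positivity
  have hmul : 0 ≤ (t + c) * ‖(f x : H)‖ ^ 2 := by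
    have hE := hc (f x)
    rw [shiftedEnergy] at hE
    linarith [hft x]
  linarith [nonneg_of_mul_nonneg_left hmul hpos]

end DenseForm

end UnboundedOp

namespace UnboundedOp.DenseForm

variable {H : Type*} [NormedAddCommGroup H] [InnerProductSpace ℂ H]

/-! ### Forms with compact resolvent -/

/-- The form `h` is symmetric, `h + c` is positive definite, and the operator of `h + c` has the
compact inverse `K`. -/
structure HasCompactResolvent (h : DenseForm H) (c : ℝ) (K : H →L[ℂ] H) : Prop where
  symm : ∀ u v, starRingEnd ℂ (h.form u v) = h.form v u
  pos : ∀ u, u ≠ 0 → 0 < shiftedEnergy h.form c u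
  compact : IsCompactOperator K
  mem_domain : ∀ f, K f ∈ h.domain
  form_add : ∀ (f : H) (v : h.domain),
    h.form ⟨K f, mem_domain f⟩ v + c * inner ℂ (v : H) (K f) = inner ℂ (v : H) f

namespace HasCompactResolvent

variable {h : DenseForm H} {c : ℝ} {K : H →L[ℂ] H}

theorem nonneg (hK : h.HasCompactResolvent c K) (u : h.domain) : 0 ≤ shiftedEnergy h.form c u := by
  rcases eq_or_ne u 0 with rfl | hu
  · simp [shiftedEnergy]
  · exact (hK.pos u hu).le

theorem eq_of_form_add_eq (hK : h.HasCompactResolvent c K) {u w : h.domain}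
    (huw : ∀ v : h.domain, h.form u v + c * inner ℂ (v : H) (u : H)
      = h.form w v + c * inner ℂ (v : H) (w : H)) : u = w := by
  by_contra hne
  have hpos := hK.pos (u - w) (sub_ne_zero.2 hne)
  have hzero : h.form (u - w) (u - w)
      + c * inner ℂ ((u - w : h.domain) : H) ((u - w : h.domain) : H) = 0 := by
    have hdiff := huw (u - w)
    rw [LinearMap.map_sub₂, Submodule.coe_sub, inner_sub_right]
    rw [Submodule.coe_sub] at hdiff
    linear_combination hdiff
  rw [shiftedEnergy_eq_re, hzero] at hpos
  exact hpos.false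

theorem two_mul_norm_sq_le (hK : h.HasCompactResolvent c K) (a : ℝ) (u : h.domain) :
    2 * a * ‖(u : H)‖ ^ 2
      ≤ shiftedEnergy h.form c u + a ^ 2 * (inner ℂ (u : H) (K u)).re := by
  set k : h.domain := ⟨K u, hK.mem_domain u⟩
  have hku : (h.form k u).re + c * (inner ℂ (u : H) (K u)).re = ‖(u : H)‖ ^ 2 := by
    rw [← re_inner_self, ← hK.form_add u u, Complex.add_re, Complex.re_ofReal_mul]
  have hkk : shiftedEnergy h.form c k = (inner ℂ (u : H) (K u)).re := by
    rw [shiftedEnergy_eq_re, hK.form_add u k, ← inner_conj_symm, Complex.conj_re]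
  have huk : (h.form u k).re = (h.form k u).re := by rw [← hK.symm k u, Complex.conj_re]
  -- The shifted energy of `u - a K u` is nonnegative.
  have hnn := hK.nonneg (u + ((-a : ℝ) : ℂ) • k)
  have hk : (k : H) = K u := rfl
  rw [shiftedEnergy_add_smul, hkk, huk, hk] at hnn
  linear_combination hnn - 2 * a * hku

theorem mem_graph_iff (hK : h.HasCompactResolvent c K) {u f : H} :
    (u, f) ∈ h.operator.graph ↔ u = K (f + (c : ℂ) • u) := by
  rw [mem_operator_graph]
  constructor
  · rintro ⟨hu, huf⟩
    refine congrArg Subtype.val (hK.eq_of_form_add_eq (u := ⟨u, hu⟩)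
      (w := ⟨K (f + (c : ℂ) • u), hK.mem_domain _⟩) fun v => ?_)
    rw [hK.form_add, huf v, inner_add_right, inner_smul_right]
  · intro hu
    have hm : u ∈ h.domain := hu ▸ hK.mem_domain _
    refine ⟨hm, fun v => ?_⟩
    have hadd := hK.form_add (f + (c : ℂ) • u) v
    simp only [← hu, inner_add_right, inner_smul_right] at hadd
    exact add_right_cancel hadd

theorem isSymmetric (hK : h.HasCompactResolvent c K) : (K : H →ₗ[ℂ] H).IsSymmetric := by
  intro f g
  have hg := hK.form_add g ⟨K f, hK.mem_domain f⟩
  have hf := congrArg (starRingEnd ℂ) (hK.form_add f ⟨K g, hK.mem_domain g⟩)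
  simp only [map_add, map_mul, hK.symm, inner_conj_symm, Complex.conj_ofReal] at hf
  exact hg.symm.trans hf

theorem injective (hK : h.HasCompactResolvent c K) : Function.Injective K := by
  rw [injective_iff_map_eq_zero]
  intro f hf
  refine h.dense.eq_zero_of_inner_right ℂ fun v hv => ?_
  have hadd := hK.form_add f ⟨v, hv⟩
  have hKf : (⟨K f, hK.mem_domain f⟩ : h.domain) = 0 := Subtype.ext hf
  rw [hKf, hf, map_zero, LinearMap.zero_apply, inner_zero_right, mul_zero, add_zero] at hadd
  exact hadd.symm

theorem eigenspace_eq (hK : h.HasCompactResolvent c K) (z : ℂ) :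
    eigenspace h.operator z = Module.End.eigenspace (K : H →ₗ[ℂ] H) (z + c)⁻¹ := by
  ext u
  have hu : u ∈ eigenspace h.operator z ↔ u = (z + c) • K u := by
    rw [← map_smul, add_smul]
    exact hK.mem_graph_iff
  rw [hu, Module.End.mem_eigenspace_iff, ContinuousLinearMap.coe_coe]
  by_cases hz : z + c = 0
  · rw [hz, inv_zero, zero_smul, zero_smul, map_eq_zero_iff K hK.injective]
  · rw [eq_inv_smul_iff₀ hz, eq_comm]

theorem apply_eigenvector (hK : h.HasCompactResolvent c K) {μ : ℝ} {v : H}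
    (hv : v ∈ eigenspace h.operator (μ : ℂ)) : K v = (((μ + c)⁻¹ : ℝ) : ℂ) • v := by
  rw [hK.eigenspace_eq, Module.End.mem_eigenspace_iff] at hv
  push_cast
  exact hv

theorem eigenvalue_real_and_pos (hK : h.HasCompactResolvent c K) {z : ℂ}
    (hz : eigenspace h.operator z ≠ ⊥) : (z.re : ℂ) = z ∧ 0 < z.re + c := by
  obtain ⟨u, hu, hu0⟩ := Submodule.exists_mem_ne_zero_of_ne_bot hz
  obtain ⟨hm, hform⟩ := mem_operator_graph.1 (show (u, z • u) ∈ h.operator.graph from hu)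
  have huu : h.form ⟨u, hm⟩ ⟨u, hm⟩ = z * ((‖u‖ ^ 2 : ℝ) : ℂ) := by
    rw [hform, inner_smul_right, inner_self_eq_norm_sq_to_K, Complex.ofReal_pow]
    rfl
  have hn : 0 < ‖u‖ ^ 2 := by positivity
  have hreal := hK.symm ⟨u, hm⟩ ⟨u, hm⟩
  have hpos := hK.pos ⟨u, hm⟩ fun h0 => hu0 (congrArg Subtype.val h0)
  rw [huu, map_mul, Complex.conj_ofReal] at hreal
  rw [shiftedEnergy, huu, Complex.re_mul_ofReal, ← add_mul] at hpos
  refine ⟨Complex.conj_eq_iff_re.1 (mul_right_cancel₀ ?_ hreal), pos_of_mul_pos_left hpos hn.le⟩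
  exact_mod_cast hn.ne'

theorem orthogonalFamily_eigenspace (hK : h.HasCompactResolvent c K) :
    OrthogonalFamily ℂ (fun μ : ℝ => eigenspace h.operator (μ : ℂ))
      fun μ => (eigenspace h.operator (μ : ℂ)).subtypeₗᵢ := by
  rintro μ ν hne ⟨u, hu⟩ ⟨v, hv⟩
  rw [hK.eigenspace_eq] at hu hv
  refine hK.isSymmetric.orthogonalFamily_eigenspaces (i := ((μ : ℂ) + c)⁻¹)
    (j := ((ν : ℂ) + c)⁻¹) (fun h0 => hne ?_) ⟨u, hu⟩ ⟨v, hv⟩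
  exact_mod_cast add_right_cancel (inv_injective h0)

theorem exists_eq_sum_eigenvectors (hK : h.HasCompactResolvent c K) (p : ℝ → Prop) {u : H}
    (hu : u ∈ ⨆ μ : ℝ, ⨆ _ : p μ, eigenspace h.operator (μ : ℂ)) :
    ∃ (s : Finset ℝ) (v : ∀ μ : ℝ, eigenspace h.operator (μ : ℂ)),
      (∀ μ ∈ s, p μ ∧ 0 < μ + c) ∧ u = ∑ μ ∈ s, (v μ : H) := by
  obtain ⟨f, hf, rfl⟩ := (Submodule.mem_iSup_iff_exists_finsupp _ _).1 hu
  have hle : ∀ μ : ℝ, ⨆ _ : p μ, eigenspace h.operator (μ : ℂ) ≤ eigenspace h.operator (μ : ℂ) :=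
    fun μ => iSup_le fun _ => le_rfl
  refine ⟨f.support, fun μ => ⟨f μ, hle μ (hf μ)⟩, fun μ hμ => ?_, rfl⟩
  have h0 : f μ ≠ 0 := Finsupp.mem_support_iff.1 hμ
  refine ⟨by_contra fun hp => h0 ?_, ?_⟩
  · simpa only [iSup_neg hp, Submodule.mem_bot] using hf μ
  · simpa only [Complex.ofReal_re] using
      (hK.eigenvalue_real_and_pos ((Submodule.ne_bot_iff _).2 ⟨_, hle μ (hf μ), h0⟩)).2

theorem re_inner_apply_sum (hK : h.HasCompactResolvent c K) (s : Finset ℝ)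
    (v : ∀ μ : ℝ, eigenspace h.operator (μ : ℂ)) :
    (inner ℂ (∑ μ ∈ s, (v μ : H)) (K (∑ μ ∈ s, (v μ : H)))).re
      = ∑ μ ∈ s, (μ + c)⁻¹ * ‖v μ‖ ^ 2 := by
  rw [map_sum, Finset.sum_congr rfl fun μ _ => hK.apply_eigenvector (v μ).2]
  exact re_inner_sum_smul hK.orthogonalFamily_eigenspace s v fun μ => (μ + c)⁻¹

theorem form_le_of_mem_spectralSubspace (hK : h.HasCompactResolvent c K) {t : ℝ} {u : H}
    (hu : u ∈ spectralSubspace h.operator t) :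
    ∃ hm : u ∈ h.domain, (h.form ⟨u, hm⟩ ⟨u, hm⟩).re ≤ t * ‖u‖ ^ 2 := by
  obtain ⟨s, v, hs, rfl⟩ := hK.exists_eq_sum_eigenvectors (· ≤ t) hu
  have hg : (∑ μ ∈ s, (v μ : H), ∑ μ ∈ s, (μ : ℂ) • (v μ : H)) ∈ h.operator.graph := by
    rw [prod_mk_sum]
    exact Submodule.sum_mem _ fun μ _ => (v μ).2
  obtain ⟨hm, hform⟩ := mem_operator_graph.1 hg
  refine ⟨hm, ?_⟩
  rw [hform, re_inner_sum_smul hK.orthogonalFamily_eigenspace s v fun μ => μ,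
    norm_sq_sum hK.orthogonalFamily_eigenspace, Finset.mul_sum]
  exact Finset.sum_le_sum fun μ hμ => mul_le_mul_of_nonneg_right (hs μ hμ).1 (by positivity)

theorem le_re_inner_of_mem_spectralSubspace (hK : h.HasCompactResolvent c K) {t : ℝ} {u : H}
    (hu : u ∈ spectralSubspace h.operator t) :
    (t + c)⁻¹ * ‖u‖ ^ 2 ≤ (inner ℂ u (K u)).re := by
  obtain ⟨s, v, hs, rfl⟩ := hK.exists_eq_sum_eigenvectors (· ≤ t) hu
  rw [hK.re_inner_apply_sum, norm_sq_sum hK.orthogonalFamily_eigenspace, Finset.mul_sum]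
  refine Finset.sum_le_sum fun μ hμ => mul_le_mul_of_nonneg_right ?_ (by positivity)
  exact inv_anti₀ (hs μ hμ).2 (by linarith [(hs μ hμ).1])

theorem spectralSubspace_eq_bot (hK : h.HasCompactResolvent c K) {t : ℝ} (ht : t + c ≤ 0) :
    spectralSubspace h.operator t = ⊥ := by
  refine iSup₂_eq_bot.2 fun μ hμ => by_contra fun hb => ?_
  have hpos := (hK.eigenvalue_real_and_pos hb).2
  rw [Complex.ofReal_re] at hpos
  linarith

theorem exists_linearIndependent_eigenvectors (hK : h.HasCompactResolvent c K) {t : ℝ}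
    {s : Set ℝ} (hs : ∀ μ ∈ s, μ ≤ t ∧ eigenspace h.operator (μ : ℂ) ≠ ⊥) :
    ∃ v : s → spectralSubspace h.operator t, LinearIndependent ℂ v := by
  have hex : ∀ μ : s, ∃ v : spectralSubspace h.operator t,
      (v : H) ∈ eigenspace h.operator ((μ : ℝ) : ℂ) ∧ v ≠ 0 := by
    rintro ⟨μ, hμ⟩
    obtain ⟨u, hu, hu0⟩ := Submodule.exists_mem_ne_zero_of_ne_bot (hs μ hμ).2
    exact ⟨⟨u, eigenspace_le_spectralSubspace _ (hs μ hμ).1 hu⟩, hu,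
      fun h0 => hu0 (congrArg Subtype.val h0)⟩
  choose v hv hv0 using hex
  exact ⟨v, linearIndependent_of_ne_zero_of_inner_eq_zero hv0 fun μ ν hne =>
    hK.orthogonalFamily_eigenspace (fun h0 => hne (Subtype.ext h0)) ⟨v μ, hv μ⟩ ⟨v ν, hv ν⟩⟩

theorem isFormalAdjoint_operator (hK : h.HasCompactResolvent c K) :
    h.operator.IsFormalAdjoint h.operator := by
  intro x y
  obtain ⟨hx, hx'⟩ := mem_operator_graph.1 (h.operator.mem_graph x)
  obtain ⟨hy, hy'⟩ := mem_operator_graph.1 (h.operator.mem_graph y)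
  rw [← hy' ⟨x, hx⟩, ← inner_conj_symm, ← hx' ⟨y, hy⟩, hK.symm]

theorem mem_trialValues_of_le_rank (hK : h.HasCompactResolvent c K) {j : ℕ} {t : ℝ}
    (ht : (j : Cardinal) ≤ Module.rank ℂ (spectralSubspace h.operator t)) :
    t ∈ h.trialValues j := by
  obtain ⟨f, hf⟩ := Module.le_rank_iff_exists_linearMap.1 ht
  have hle : spectralSubspace h.operator t ≤ h.domain := fun u hu =>
    (hK.form_le_of_mem_spectralSubspace hu).1
  exact ⟨(Submodule.inclusion hle).comp f, (Submodule.inclusion_injective hle).comp hf,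
    fun x => (hK.form_le_of_mem_spectralSubspace (f x).2).2⟩

end HasCompactResolvent

end UnboundedOp.DenseForm

namespace UnboundedOp.DenseForm.HasCompactResolvent

variable {H : Type*} [NormedAddCommGroup H] [InnerProductSpace ℂ H] [CompleteSpace H]
  {h : DenseForm H} {c : ℝ} {K : H →L[ℂ] H}

/-! ### Spectral theorem and min-max principle -/

theorem iSup_eigenspace_orthogonal (hK : h.HasCompactResolvent c K) :
    (⨆ μ : ℝ, eigenspace h.operator (μ : ℂ))ᗮ = ⊥ := by
  rw [eq_bot_iff, ← K.orthogonalComplement_iSup_eigenspaces_eq_bot hK.compact hK.isSymmetric]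
  refine Submodule.orthogonal_le (iSup_le fun z => ?_)
  have heq := hK.eigenspace_eq (z⁻¹ - c)
  rw [sub_add_cancel, inv_inv] at heq
  rw [← heq]
  by_cases hb : eigenspace h.operator (z⁻¹ - c) = ⊥
  · exact hb.trans_le bot_le
  · rw [← (hK.eigenvalue_real_and_pos hb).1]
    exact le_iSup (fun μ : ℝ => eigenspace h.operator (μ : ℂ)) _

theorem dense_operator_domain (hK : h.HasCompactResolvent c K) :
    Dense (h.operator.domain : Set H) := by
  rw [Submodule.dense_iff_topologicalClosure_eq_top, Submodule.topologicalClosure_eq_top_iff,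
    eq_bot_iff, ← hK.iSup_eigenspace_orthogonal]
  exact Submodule.orthogonal_le (iSup_le fun μ u hu => (mem_eigenspace.1 hu).1)

theorem isSelfAdjoint_operator (hK : h.HasCompactResolvent c K) : IsSelfAdjoint h.operator := by
  rw [LinearPMap.isSelfAdjoint_def]
  refine le_antisymm ?_ (hK.isFormalAdjoint_operator.le_adjoint hK.dense_operator_domain)
  rw [← LinearPMap.le_graph_iff]
  rintro ⟨u, g⟩ hug
  rw [hK.mem_graph_iff]
  refine ext_inner_right ℂ fun f => ?_
  obtain ⟨y, rfl, rfl⟩ := (LinearPMap.mem_graph_iff _).1 hug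
  obtain ⟨x, hx, hAx⟩ := (LinearPMap.mem_graph_iff _).1
    (hK.mem_graph_iff.2 (by rw [sub_add_cancel]) : (K f, f - (c : ℂ) • K f) ∈ h.operator.graph)
  have hadj := LinearPMap.adjoint_isFormalAdjoint hK.dense_operator_domain y x
  have hsymm := hK.isSymmetric (h.operator.adjoint y + (c : ℂ) • (y : H)) f
  simp only [ContinuousLinearMap.coe_coe] at hx hAx hsymm
  rw [hx, hAx, inner_sub_right, inner_smul_right] at hadj
  rw [hsymm, inner_add_left, inner_smul_left, Complex.conj_ofReal]
  linear_combination -hadj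

theorem finiteDimensional_spectralSubspace (hK : h.HasCompactResolvent c K) (t : ℝ) :
    FiniteDimensional ℂ (spectralSubspace h.operator t) := by
  rcases le_or_gt (t + c) 0 with ht | ht
  · rw [hK.spectralSubspace_eq_bot ht]; infer_instance
  refine finiteDimensional_of_isCompactOperator_of_le_re_inner hK.compact (fun u hu => ?_)
    (inv_pos.2 ht) fun u hu => hK.le_re_inner_of_mem_spectralSubspace hu
  have hinv : spectralSubspace h.operator t ≤
      (spectralSubspace h.operator t).comap (K : H →ₗ[ℂ] H) := by
    refine iSup₂_le fun μ hμ v hv => ?_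
    rw [Submodule.mem_comap, ContinuousLinearMap.coe_coe, hK.apply_eigenvector hv]
    exact Submodule.smul_mem _ _ (eigenspace_le_spectralSubspace _ hμ hv)
  exact hinv hu

theorem orthogonal_spectralSubspace_le (hK : h.HasCompactResolvent c K) (t : ℝ) :
    (spectralSubspace h.operator t)ᗮ ≤
      (⨆ μ : ℝ, ⨆ _ : t < μ, eigenspace h.operator (μ : ℂ)).topologicalClosure := by
  set N := spectralSubspace h.operator t
  set P : Submodule ℂ H := ⨆ μ : ℝ, ⨆ _ : t < μ, eigenspace h.operator (μ : ℂ)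
  have : FiniteDimensional ℂ N := hK.finiteDimensional_spectralSubspace t
  have hPN : P ⟂ N := by
    simp only [P, N, spectralSubspace, Submodule.isOrtho_iSup_left, Submodule.isOrtho_iSup_right]
    exact fun μ hμ ν hν => hK.orthogonalFamily_eigenspace.isOrtho (lt_of_le_of_lt hμ hν).ne'
  have hbot : Nᗮ ⊓ Pᗮ = ⊥ := by
    rw [Submodule.inf_orthogonal, eq_bot_iff, ← hK.iSup_eigenspace_orthogonal]
    refine Submodule.orthogonal_le (iSup_le fun μ => ?_)
    rcases le_or_gt μ t with hμ | hμ
    · exact (eigenspace_le_spectralSubspace _ hμ).trans le_sup_left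
    · exact (le_iSup₂_of_le (f := fun (μ : ℝ) (_ : t < μ) => eigenspace h.operator (μ : ℂ))
        μ hμ le_rfl).trans le_sup_right
  have hPorth : Pᗮ ≤ N := by
    intro w hw
    have hmem : w - N.starProjection w ∈ Nᗮ ⊓ Pᗮ :=
      ⟨N.sub_starProjection_mem_orthogonal w,
        Pᗮ.sub_mem hw (hPN.symm (N.starProjection_apply_mem w))⟩
    rw [hbot, Submodule.mem_bot, sub_eq_zero] at hmem
    rw [hmem]
    exact N.starProjection_apply_mem w
  rw [← Submodule.orthogonal_orthogonal_eq_closure]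
  exact Submodule.orthogonal_le hPorth

theorem re_inner_le_of_mem_orthogonal (hK : h.HasCompactResolvent c K) {t : ℝ} (ht : 0 < t + c)
    {u : H} (hu : u ∈ (spectralSubspace h.operator t)ᗮ) :
    (inner ℂ u (K u)).re ≤ (t + c)⁻¹ * ‖u‖ ^ 2 := by
  have hcl : IsClosed {u : H | (inner ℂ u (K u)).re ≤ (t + c)⁻¹ * ‖u‖ ^ 2} :=
    isClosed_le (Complex.continuous_re.comp (by fun_prop)) (by fun_prop)
  refine closure_minimal (fun w hw => ?_) hcl (hK.orthogonal_spectralSubspace_le t hu)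
  obtain ⟨s, v, hs, rfl⟩ := hK.exists_eq_sum_eigenvectors (t < ·) hw
  rw [mem_ofPred_eq, hK.re_inner_apply_sum, norm_sq_sum hK.orthogonalFamily_eigenspace,
    Finset.mul_sum]
  refine Finset.sum_le_sum fun μ hμ => mul_le_mul_of_nonneg_right ?_ (by positivity)
  exact inv_anti₀ ht (by linarith [(hs μ hμ).1])

theorem le_form_of_mem_orthogonal (hK : h.HasCompactResolvent c K) {t : ℝ} (u : h.domain)
    (hu : (u : H) ∈ (spectralSubspace h.operator t)ᗮ) :
    t * ‖(u : H)‖ ^ 2 ≤ (h.form u u).re := by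
  suffices (t + c) * ‖(u : H)‖ ^ 2 ≤ shiftedEnergy h.form c u by
    rw [shiftedEnergy] at this
    linarith
  rcases le_or_gt (t + c) 0 with ht | ht
  · exact (mul_nonpos_of_nonpos_of_nonneg ht (by positivity)).trans (hK.nonneg u)
  · have hupper : (t + c) ^ 2 * (inner ℂ (u : H) (K u)).re ≤ (t + c) * ‖(u : H)‖ ^ 2 :=
      calc _ ≤ (t + c) ^ 2 * ((t + c)⁻¹ * ‖(u : H)‖ ^ 2) := by
            gcongr
            exact hK.re_inner_le_of_mem_orthogonal ht hu
        _ = _ := by field_simp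
    linarith [hK.two_mul_norm_sq_le (t + c) u]

theorem isUnit_one_sub_smul (hK : h.HasCompactResolvent c K) {z : ℂ}
    (hz : eigenspace h.operator z = ⊥) : IsUnit (1 - (z + c) • K) := by
  by_cases h0 : z + c = 0
  · rw [h0, zero_smul, sub_zero]
    exact isUnit_one
  rcases hK.compact.hasEigenvalue_or_mem_resolventSet (inv_ne_zero h0) with hev | hres
  · exact absurd ((hK.eigenspace_eq z).symm.trans hz) hev
  · have hsmul : 1 - (z + c) • K
        = Units.mk0 (z + c) h0 • (algebraMap ℂ (H →L[ℂ] H) (z + c)⁻¹ - K) := by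
      rw [Algebra.algebraMap_eq_smul_one, smul_sub, Units.smul_mk0, Units.smul_mk0,
        smul_smul, mul_inv_cancel₀ h0, one_smul]
    rw [hsmul]
    exact (isUnit_smul_iff _ _).2 hres

theorem eigenspace_ne_bot_of_mem_spectrum (hK : h.HasCompactResolvent c K) {z : ℂ}
    (hz : z ∈ spectrum h.operator) : eigenspace h.operator z ≠ ⊥ := by
  intro hb
  obtain ⟨W, hW⟩ := hK.isUnit_one_sub_smul hb
  have hWu : ∀ u, (W : H →L[ℂ] H) u = u - (z + c) • K u := fun u => by rw [hW]; rfl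
  refine hz (mem_resolventSet_of_mem_graph_iff ((↑W⁻¹ : H →L[ℂ] H) * K) fun u f => ?_)
  calc (u, f) ∈ h.operator.graph ↔ u = K (f + (c : ℂ) • u) := hK.mem_graph_iff
    _ ↔ (W : H →L[ℂ] H) u = K (f - z • u) := by
      rw [hWu, sub_eq_iff_eq_add, ← map_smul, ← map_add, add_smul, ← add_assoc, sub_add_cancel]
    _ ↔ u = (↑W⁻¹ : H →L[ℂ] H) (K (f - z • u)) := by
      constructor <;> intro hu
      · rw [← hu]
        exact (DFunLike.congr_fun W.inv_mul u).symm
      · conv_lhs => rw [hu]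
        exact DFunLike.congr_fun W.mul_inv _

theorem finite_eigenvalues_le (hK : h.HasCompactResolvent c K) (t : ℝ) :
    {μ : ℝ | μ ≤ t ∧ eigenspace h.operator (μ : ℂ) ≠ ⊥}.Finite := by
  have := hK.finiteDimensional_spectralSubspace t
  obtain ⟨v, hv⟩ := hK.exists_linearIndependent_eigenvectors (t := t)
    (s := {μ | μ ≤ t ∧ eigenspace h.operator (μ : ℂ) ≠ ⊥}) fun _ hμ => hμ
  exact Set.finite_coe_iff.1 hv.finite_of_isNoetherian

theorem hasPurelyDiscreteSpectrum (hK : h.HasCompactResolvent c K)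
    (hinf : ¬ FiniteDimensional ℂ H) : HasPurelyDiscreteSpectrum h.operator where
  isolated z _ hacc := by
    have hU : {w : ℂ | w.re < z.re + 1} ∈ 𝓝 z :=
      (isOpen_lt Complex.continuous_re continuous_const).mem_nhds (lt_add_one z.re)
    refine Set.Infinite.of_accPt (hacc.nhds_inter hU) (((hK.finite_eigenvalues_le (z.re + 1)).image
      fun t : ℝ => (t : ℂ)).subset ?_)
    rintro w ⟨hwz, hw⟩
    have hb := hK.eigenspace_ne_bot_of_mem_spectrum hw
    have hr := (hK.eigenvalue_real_and_pos hb).1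
    exact ⟨w.re, ⟨le_of_lt hwz, by rwa [hr]⟩, hr⟩
  isEigenvalue z hz := hK.eigenspace_ne_bot_of_mem_spectrum hz
  finiteDimensional z hz := by
    have := hK.finiteDimensional_spectralSubspace z.re
    rw [← (hK.eigenvalue_real_and_pos (hK.eigenspace_ne_bot_of_mem_spectrum hz)).1]
    exact Submodule.finiteDimensional_of_le (eigenspace_le_spectralSubspace _ le_rfl)
  bddBelow := by
    refine ⟨-c, fun t ht => ?_⟩
    have hpos := (hK.eigenvalue_real_and_pos (hK.eigenspace_ne_bot_of_mem_spectrum ht)).2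
    rw [Complex.ofReal_re] at hpos
    linarith
  not_bddAbove := by
    rintro ⟨t, ht⟩
    have hfd := hK.finiteDimensional_spectralSubspace t
    have hle : ⨆ μ : ℝ, eigenspace h.operator (μ : ℂ) ≤ spectralSubspace h.operator t := by
      refine iSup_le fun μ => ?_
      by_cases hb : eigenspace h.operator (μ : ℂ) = ⊥
      · exact hb.trans_le bot_le
      · exact eigenspace_le_spectralSubspace _ (ht (mem_spectrum_of_eigenspace_ne_bot hb))
    have htop := Submodule.orthogonal_le hle
    rw [hK.iSup_eigenspace_orthogonal, le_bot_iff, Submodule.orthogonal_eq_bot_iff] at htop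
    rw [htop] at hfd
    exact hinf (Module.Finite.equiv (Submodule.topEquiv (R := ℂ) (M := H)))

theorem trialValues_nonempty (hK : h.HasCompactResolvent c K)
    (hinf : ¬ FiniteDimensional ℂ H) (j : ℕ) : (h.trialValues j).Nonempty := by
  have hspec : {t : ℝ | (t : ℂ) ∈ spectrum h.operator}.Infinite := fun hfin =>
    (hK.hasPurelyDiscreteSpectrum hinf).not_bddAbove hfin.bddAbove
  obtain ⟨F, hF, hcard⟩ := hspec.exists_subset_card_eq j
  obtain ⟨t, ht⟩ := F.finite_toSet.bddAbove
  obtain ⟨v, hv⟩ := hK.exists_linearIndependent_eigenvectors (s := F)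
    fun μ hμ => ⟨ht hμ, hK.eigenspace_ne_bot_of_mem_spectrum (hF hμ)⟩
  refine ⟨t, hK.mem_trialValues_of_le_rank ?_⟩
  simpa [hcard] using hv.cardinal_lift_le_rank

theorem le_rank_of_mem_trialValues (hK : h.HasCompactResolvent c K) {j : ℕ} {s t : ℝ}
    (hs : s ∈ h.trialValues j) (hst : s < t) :
    (j : Cardinal) ≤ Module.rank ℂ (spectralSubspace h.operator t) := by
  obtain ⟨f, hf, hfs⟩ := hs
  set N := spectralSubspace h.operator t
  have hfd : FiniteDimensional ℂ N := hK.finiteDimensional_spectralSubspace t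
  by_contra hlt
  rw [not_le, ← Module.finrank_eq_rank, Nat.cast_lt] at hlt
  let g : (Fin j → ℂ) →ₗ[ℂ] N :=
    (N.orthogonalProjectionOnto : H →ₗ[ℂ] N).comp (h.domain.subtype.comp f)
  obtain ⟨x, hx, hx0⟩ := Submodule.exists_mem_ne_zero_of_ne_bot
    (LinearMap.ker_ne_bot_of_finrank_lt (f := g) (by simpa using hlt))
  have hmem : (f x : H) ∈ Nᗮ := N.orthogonalProjectionOnto_eq_zero_iff.1 hx
  have hfx : (f x : H) ≠ 0 := by simpa [map_eq_zero_iff f hf] using hx0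
  have hpos : 0 < ‖(f x : H)‖ ^ 2 := by positivity
  have hts := (hK.le_form_of_mem_orthogonal (f x) hmem).trans (hfs x)
  exact hst.not_ge (le_of_mul_le_mul_right hts hpos)

theorem nthEigenvalue_eq_sInf_trialValues (hK : h.HasCompactResolvent c K)
    (hinf : ¬ FiniteDimensional ℂ H) {j : ℕ} (hj : 1 ≤ j) :
    nthEigenvalue h.operator j = sInf (h.trialValues j) := by
  have hbdd : BddBelow (h.trialValues j) :=
    ⟨-c, fun t ht => neg_le_of_mem_trialValues hK.nonneg hj ht⟩
  have hsub : {t : ℝ | (j : Cardinal) ≤ Module.rank ℂ (spectralSubspace h.operator t)} ⊆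
      h.trialValues j := fun t ht => hK.mem_trialValues_of_le_rank ht
  have hrank : ∀ s ∈ h.trialValues j, ∀ ε > 0, s + ε ∈
      {t : ℝ | (j : Cardinal) ≤ Module.rank ℂ (spectralSubspace h.operator t)} :=
    fun s hs ε hε => hK.le_rank_of_mem_trialValues hs (lt_add_of_pos_right s hε)
  have hne := hK.trialValues_nonempty hinf j
  obtain ⟨s, hs⟩ := hne
  exact le_antisymm
    (le_csInf ⟨s, hs⟩ fun b hb => le_of_forall_pos_le_add fun ε hε =>
      csInf_le (hbdd.mono hsub) (hrank b hb ε hε))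
    (csInf_le_csInf hbdd ⟨s + 1, hrank s hs 1 one_pos⟩ hsub)

end UnboundedOp.DenseForm.HasCompactResolvent

/-! ### Compactness of the resolvent -/

namespace UnboundedOp

variable {V : Type*} [NormedAddCommGroup V] [InnerProductSpace ℂ V]
  {H : Type*} [NormedAddCommGroup H] [InnerProductSpace ℂ H]

theorem finiteDimensional_orthogonal_ker {W : Type*} [NormedAddCommGroup W] [NormedSpace ℂ W]
    [FiniteDimensional ℂ W] (F : V →ₗ[ℂ] W) : FiniteDimensional ℂ (LinearMap.ker F)ᗮ := by
  refine FiniteDimensional.of_injective (F.comp (LinearMap.ker F)ᗮ.subtype) ?_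
  rw [injective_iff_map_eq_zero]
  intro u hu
  have hmem : (u : V) ∈ LinearMap.ker F ⊓ (LinearMap.ker F)ᗮ := ⟨hu, u.2⟩
  rw [Submodule.inf_orthogonal_eq_bot, Submodule.mem_bot] at hmem
  exact Subtype.ext hmem

theorem isCompactOperator_comp_starProjection (J : V →L[ℂ] H) (N : Submodule ℂ V)
    [FiniteDimensional ℂ N] : IsCompactOperator (J.comp N.starProjection) := by
  have := LocallyCompactSpace.of_finiteDimensional_of_complete ℂ N
  exact (isCompactOperator_of_locallyCompactSpace_rng (J.comp N.subtypeL)).comp_clm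
    N.orthogonalProjectionOnto

variable [CompleteSpace V] [CompleteSpace H]

theorem inner_add_smul_adjoint_comp (T : V →L[ℂ] V) (J : V →L[ℂ] H) (c : ℝ) (u v : V) :
    inner ℂ v ((T + (c : ℂ) • (J.adjoint.comp J)) u)
      = inner ℂ v (T u) + c * inner ℂ (J v) (J u) := by
  simp [ContinuousLinearMap.adjoint_inner_right]

theorem isUnit_add_smul_adjoint_comp (T : V →L[ℂ] V) (J : V →L[ℂ] H) {c ε : ℝ} (hε : 0 < ε)
    (hcoer : ∀ u, ε * ‖u‖ ^ 2 ≤ (inner ℂ u (T u)).re + c * ‖J u‖ ^ 2) :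
    IsUnit (T + (c : ℂ) • (J.adjoint.comp J)) := by
  refine isUnit_of_le_re_inner _ hε fun u => ?_
  rw [inner_add_smul_adjoint_comp, Complex.add_re, Complex.re_ofReal_mul, re_inner_self]
  exact hcoer u

/-- The Lax-Milgram theorem for a form on `V`, given by an operator `T` and coercive up to a
multiple of the norm of `H`, where `V` is compactly embedded in `H` by `J`. -/
theorem DenseForm.exists_hasCompactResolvent (h : DenseForm H) {J : V →L[ℂ] H}
    (hJ : IsCompactOperator J) (hJm : ∀ u, J u ∈ h.domain)
    (hJs : ∀ w : h.domain, ∃ u, ⟨J u, hJm u⟩ = w) {T : V →L[ℂ] V}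
    (hT : (T : V →ₗ[ℂ] V).IsSymmetric)
    (hform : ∀ u v, h.form ⟨J u, hJm u⟩ ⟨J v, hJm v⟩ = inner ℂ v (T u)) {c ε : ℝ} (hε : 0 < ε)
    (hcoer : ∀ u, ε * ‖u‖ ^ 2 ≤ (inner ℂ u (T u)).re + c * ‖J u‖ ^ 2) :
    ∃ K : H →L[ℂ] H, h.HasCompactResolvent c K := by
  obtain ⟨W, hW⟩ := isUnit_add_smul_adjoint_comp T J hε hcoer
  refine ⟨J.comp ((↑W⁻¹ : V →L[ℂ] V).comp J.adjoint), fun u v => ?_, fun u hu0 => ?_,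
    hJ.comp_clm _, fun f => hJm _, fun f v => ?_⟩
  · obtain ⟨u, rfl⟩ := hJs u
    obtain ⟨v, rfl⟩ := hJs v
    rw [hform, hform, inner_conj_symm]
    exact hT u v
  · obtain ⟨u, rfl⟩ := hJs u
    have hu : u ≠ 0 := by
      rintro rfl
      exact hu0 (Subtype.ext (map_zero J))
    rw [shiftedEnergy, hform]
    exact lt_of_lt_of_le (by positivity) (hcoer u)
  · obtain ⟨v, rfl⟩ := hJs v
    have hinv : (W : V →L[ℂ] V) ((↑W⁻¹ : V →L[ℂ] V) (J.adjoint f)) = J.adjoint f :=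
      DFunLike.congr_fun W.mul_inv _
    rw [← J.adjoint_inner_right v f, ← hinv, hW, inner_add_smul_adjoint_comp]
    exact congrArg₂ (· + ·) (hform _ v) rfl

theorem isCompactOperator_of_forall_exists_finite (J : V →L[ℂ] H)
    (hJ : ∀ ε : ℝ, 0 < ε → ∃ S : Set (V →L[ℂ] ℂ), S.Finite ∧
      ∀ u, (∀ ℓ ∈ S, ℓ u = 0) → ‖J u‖ ≤ ε * ‖u‖) : IsCompactOperator J := by
  have hcl := isClosed_setOfPred_isCompactOperator (𝕜₁ := ℂ) (𝕜₂ := ℂ) (σ₁₂ := RingHom.id ℂ)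
    (M₁ := V) (M₂ := H)
  refine hcl.closure_subset (Metric.mem_closure_iff.2 fun ε hε => ?_)
  obtain ⟨S, hS, hJS⟩ := hJ (ε / 2) (half_pos hε)
  have := hS.fintype
  let F : V →L[ℂ] (S → ℂ) := ContinuousLinearMap.pi fun ℓ => (ℓ : V →L[ℂ] ℂ)
  let N : Submodule ℂ V := LinearMap.ker (F : V →ₗ[ℂ] (S → ℂ))
  have : CompleteSpace N := F.isClosed_ker.completeSpace_coe
  have : FiniteDimensional ℂ Nᗮ := finiteDimensional_orthogonal_ker (F : V →ₗ[ℂ] (S → ℂ))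
  refine ⟨J.comp Nᗮ.starProjection, isCompactOperator_comp_starProjection J Nᗮ, ?_⟩
  rw [dist_eq_norm]
  refine lt_of_le_of_lt (ContinuousLinearMap.opNorm_le_bound _ (half_pos hε).le fun u => ?_)
    (half_lt_self hε)
  have hsub : (J - J.comp Nᗮ.starProjection) u = J (N.starProjection u) := by
    rw [sub_apply, ContinuousLinearMap.comp_apply, ← map_sub]
    exact congrArg J (sub_eq_of_eq_add (N.starProjection_add_starProjection_orthogonal u).symm)
  have hker : F (N.starProjection u) = 0 := N.starProjection_apply_mem u
  rw [hsub]
  refine (hJS _ fun ℓ hℓ => congrFun hker ⟨ℓ, hℓ⟩).trans ?_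
  gcongr
  exact N.norm_starProjection_apply_le u

theorem exists_isSymmetric_of_form {ι : Type*} [Fintype ι] (G : V →L[ℂ] H) (e : ι → V →L[ℂ] ℂ)
    (γ : ι → ℝ) :
    ∃ T : V →L[ℂ] V, (T : V →ₗ[ℂ] V).IsSymmetric ∧ ∀ u v, inner ℂ v (T u)
      = inner ℂ (G v) (G u) + ∑ i, γ i * (e i u * starRingEnd ℂ (e i v)) := by
  let T : V →L[ℂ] V := G.adjoint.comp G + ∑ i, (γ i : ℂ) • (e i).adjoint.comp (e i)
  have hT : ∀ u v, inner ℂ v (T u)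
      = inner ℂ (G v) (G u) + ∑ i, γ i * (e i u * starRingEnd ℂ (e i v)) := by
    intro u v
    simp [T, ContinuousLinearMap.adjoint_inner_right]
  refine ⟨T, fun u v => ?_, hT⟩
  change inner ℂ (T u) v = inner ℂ u (T v)
  rw [← inner_conj_symm, hT, hT]
  simp [mul_comm]

end UnboundedOp

/-! ### Sobolev functions on an interval -/

namespace IntervalSobolev

variable {a b : ℝ}

theorem memLp_of_continuousOn {w : ℝ → ℂ} (hw : ContinuousOn w (Icc a b)) :
    MemLp w 2 (volume.restrict (Ioo a b)) := by
  obtain ⟨C, hC⟩ := isCompact_Icc.exists_bound_of_continuousOn hw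
  refine MemLp.of_bound ((hw.mono Ioo_subset_Icc_self).aestronglyMeasurable measurableSet_Ioo) C ?_
  exact (ae_restrict_iff' measurableSet_Ioo).2
    (Eventually.of_forall fun x hx => hC x (Ioo_subset_Icc_self hx))

theorem integrableOn_Icc (g : L2 a b) : IntegrableOn (fun x => g x) (Icc a b) :=
  (integrableOn_Icc_iff_integrableOn_Ioo (by finiteness) (by finiteness)).2 (integrable_coe g)

theorem intervalIntegrable (g : L2 a b) {x y : ℝ} (hx : x ∈ Icc a b) (hy : y ∈ Icc a b) :
    IntervalIntegrable (fun x => g x) volume x y := by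
  rw [intervalIntegrable_iff]
  exact (integrableOn_Icc g).mono_set (uIoc_subset_uIcc.trans (uIcc_subset_Icc hx hy))

theorem continuousOn_primitive (hab : a ≤ b) (g : L2 a b) :
    ContinuousOn (fun x => ∫ t in a..x, g t) (Icc a b) := by
  rw [← uIcc_of_le hab]
  exact intervalIntegral.continuousOn_primitive_interval'
    (intervalIntegrable g (left_mem_Icc.2 hab) (right_mem_Icc.2 hab)) left_mem_uIcc

theorem integral_deriv_test (hab : a < b) {φ : ℝ → ℂ} (hφ : IsTest a b φ) :
    ∫ x in Ioo a b, deriv φ x = 0 := by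
  rw [← integral_Ioc_eq_integral_Ioo, ← intervalIntegral.integral_of_le hab.le,
    intervalIntegral.integral_deriv_eq_sub (fun x _ => (hφ.contDiff.differentiable
      (by simp)).differentiableAt) (hφ.deriv.contDiff.continuous.intervalIntegrable _ _),
    hφ.eq_zero (x := b) (by simp), hφ.eq_zero (x := a) (by simp), sub_self]

theorem hasWeakDeriv_of_ae_eq_primitive (hab : a < b) {u g : L2 a b} {c : ℂ}
    (hu : u =ᵐ[volume.restrict (Ioo a b)] fun x => (∫ t in a..x, g t) + c) :
    HasWeakDeriv u g := by
  intro φ hφ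
  have hφi : Integrable (deriv φ) (volume.restrict (Ioo a b)) :=
    hφ.deriv.memLp.integrable (by norm_num)
  have hGφ : Integrable (fun x => (∫ t in a..x, g t) * deriv φ x) (volume.restrict (Ioo a b)) :=
    (memLp_of_continuousOn (continuousOn_primitive hab.le g)).integrable_mul hφ.deriv.memLp
  calc ∫ x in Ioo a b, u x * deriv φ x
      = ∫ x in Ioo a b, ((∫ t in a..x, g t) * deriv φ x + c * deriv φ x) :=
        integral_congr_ae <| by filter_upwards [hu] with x hx; rw [hx, add_mul]
    _ = -∫ x in Ioo a b, g x * φ x := by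
        rw [integral_add hGφ (hφi.const_mul c), integral_const_mul, integral_deriv_test hab hφ,
          integral_primitive_mul_deriv (integrable_coe g) hφ, mul_zero, add_zero]

theorem exists_primitive (hab : a < b) (g : L2 a b) (c : ℂ) :
    ∃ u : W12 a b, weakDeriv a b u = g ∧ ∀ x (hx : x ∈ Icc a b),
      eval hab x hx u = (∫ t in a..x, g t) + c := by
  have hcont : ContinuousOn (fun x => (∫ t in a..x, g t) + c) (Icc a b) :=
    (continuousOn_primitive hab.le g).add continuousOn_const
  have hL := memLp_of_continuousOn hcont
  have hw : HasWeakDeriv (hL.toLp _) g := hasWeakDeriv_of_ae_eq_primitive hab hL.coeFn_toLp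
  exact ⟨⟨hL.toLp _, g, hw⟩, (hasWeakDeriv_weakDeriv _).unique hw, fun x hx =>
    eval_eq hab hx _ hcont hL.coeFn_toLp⟩

theorem eval_eq_eval_of_weakDeriv_eq_zero (hab : a < b) {u : W12 a b}
    (hu : weakDeriv a b u = 0) {x y : ℝ} (hx : x ∈ Icc a b) (hy : y ∈ Icc a b) :
    eval hab x hx u = eval hab y hy u := by
  obtain ⟨c, hc⟩ := ae_eq_const_of_test hab (integrable_coe (u : L2 a b)) fun φ hφ => by
    rw [hasWeakDeriv_weakDeriv u φ hφ, hu, neg_eq_zero]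
    refine integral_eq_zero_of_ae ?_
    filter_upwards [Lp.coeFn_zero ℂ 2 (volume.restrict (Ioo a b))] with t ht
    rw [ht, Pi.zero_apply, zero_mul]
  rw [eval_eq hab hx u continuousOn_const hc, eval_eq hab hy u continuousOn_const hc]

theorem eval_eq_primitive (hab : a < b) (u : W12 a b) {x : ℝ} (hx : x ∈ Icc a b) :
    eval hab x hx u
      = (∫ t in a..x, weakDeriv a b u t) + eval hab a (left_mem_Icc.2 hab.le) u := by
  have ha := left_mem_Icc.2 hab.le
  obtain ⟨v, hv, hvx⟩ := exists_primitive hab (weakDeriv a b u) (eval hab a ha u)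
  have h : eval hab x hx (u - v) = eval hab a ha (u - v) :=
    eval_eq_eval_of_weakDeriv_eq_zero hab (by rw [map_sub, hv, sub_self]) hx ha
  rwa [map_sub, map_sub, hvx a ha, hvx x hx, intervalIntegral.integral_same, zero_add, sub_self,
    sub_eq_zero] at h

theorem ae_eq_eval (hab : a < b) (u : W12 a b) :
    ∀ᵐ x ∂(volume.restrict (Ioo a b)), ∀ hx : x ∈ Icc a b, (u : L2 a b) x = eval hab x hx u := by
  obtain ⟨w, hw, huw⟩ := exists_continuous_rep hab u
  filter_upwards [huw] with x hx hxI
  rw [hx, eval_eq hab hxI u hw huw]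

theorem norm_setIntegral_le (g : L2 a b) {x y : ℝ} (hx : a ≤ x) (hxy : x ≤ y) (hy : y ≤ b) :
    ‖∫ t in Ioo x y, g t‖ ≤ √(y - x) * ‖g‖ := by
  have hsub : Ioo x y ⊆ Ioo a b := Ioo_subset_Ioo hx hy
  have hμ : (volume.restrict (Ioo a b)) (Ioo x y) = ENNReal.ofReal (y - x) := by
    rw [Measure.restrict_apply measurableSet_Ioo, inter_eq_left.2 hsub, Real.volume_Ioo]
  have hinner := L2.inner_indicatorConstLp_one (𝕜 := ℂ) (measurableSet_Ioo (a := x) (b := y))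
    (by rw [hμ]; finiteness) g
  rw [Measure.restrict_restrict measurableSet_Ioo, inter_eq_left.2 hsub] at hinner
  calc ‖∫ t in Ioo x y, g t‖
      ≤ ‖indicatorConstLp 2 measurableSet_Ioo (by rw [hμ]; finiteness) (1 : ℂ)‖ * ‖g‖ := by
        rw [← hinner]; exact norm_inner_le_norm _ _
    _ = √(y - x) * ‖g‖ := by
        rw [norm_indicatorConstLp (by norm_num) (by norm_num), measureReal_def, hμ,
          ENNReal.toReal_ofReal (by linarith), norm_one, one_mul, Real.sqrt_eq_rpow]
        norm_num

theorem norm_eval_sub_le (hab : a < b) (u : W12 a b) {x y : ℝ} (hx : x ∈ Icc a b)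
    (hy : y ∈ Icc a b) :
    ‖eval hab y hy u - eval hab x hx u‖ ≤ √|y - x| * ‖weakDeriv a b u‖ := by
  wlog hxy : x ≤ y generalizing x y
  · rw [norm_sub_rev, abs_sub_comm]
    exact this hy hx (le_of_not_ge hxy)
  have ha := left_mem_Icc.2 hab.le
  have hdiff : eval hab y hy u - eval hab x hx u = ∫ t in Ioo x y, weakDeriv a b u t := by
    rw [eval_eq_primitive hab u hy, eval_eq_primitive hab u hx, add_sub_add_right_eq_sub,
      intervalIntegral.integral_interval_sub_left (intervalIntegrable _ ha hy)
        (intervalIntegrable _ ha hx), intervalIntegral.integral_of_le hxy,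
      integral_Ioc_eq_integral_Ioo]
  rw [hdiff, abs_of_nonneg (sub_nonneg.2 hxy)]
  exact norm_setIntegral_le _ hx.1 hxy hy.2

theorem norm_le_of_eval_le (hab : a < b) (u : W12 a b) {C : ℝ} (hC : 0 ≤ C)
    (h : ∀ x (hx : x ∈ Icc a b), ‖eval hab x hx u‖ ≤ C) :
    ‖(u : L2 a b)‖ ≤ √(b - a) * C := by
  have hbound : ∀ᵐ x ∂(volume.restrict (Ioo a b)), ‖(u : L2 a b) x‖ ≤ C := by
    filter_upwards [ae_eq_eval hab u, ae_restrict_mem measurableSet_Ioo] with x hx hxI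
    rw [hx (Ioo_subset_Icc_self hxI)]
    exact h x _
  refine (Lp.norm_le_of_ae_bound hC hbound).trans_eq ?_
  congr 1
  rw [measureUnivNNReal, Real.sqrt_eq_rpow]
  simp [ENNReal.coe_toNNReal_eq_toReal, hab.le]

theorem norm_le_of_forall_exists_eval_eq_zero (hab : a < b) {u : W12 a b} {d : ℝ}
    (h : ∀ x ∈ Icc a b, ∃ y, ∃ hy : y ∈ Icc a b, |x - y| ≤ d ∧ eval hab y hy u = 0) :
    ‖(u : L2 a b)‖ ≤ √(b - a) * (√d * ‖weakDeriv a b u‖) := by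
  refine norm_le_of_eval_le hab u (by positivity) fun x hx => ?_
  obtain ⟨y, hy, hxy, hu⟩ := h x hx
  calc ‖eval hab x hx u‖ = ‖eval hab x hx u - eval hab y hy u‖ := by rw [hu, sub_zero]
    _ ≤ √|x - y| * ‖weakDeriv a b u‖ := norm_eval_sub_le hab u hy hx
    _ ≤ √d * ‖weakDeriv a b u‖ := by gcongr

theorem norm_le_of_eval_left_eq_zero (hab : a < b) {u : W12 a b}
    (hu : eval hab a (left_mem_Icc.2 hab.le) u = 0) :
    ‖(u : L2 a b)‖ ≤ (b - a) * ‖weakDeriv a b u‖ := by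
  have h := norm_le_of_forall_exists_eval_eq_zero hab (u := u) (d := b - a) fun x hx =>
    ⟨a, left_mem_Icc.2 hab.le, by rw [abs_of_nonneg] <;> linarith [hx.1, hx.2], hu⟩
  rwa [← mul_assoc, Real.mul_self_sqrt (sub_nonneg.2 hab.le)] at h

theorem norm_mul_eval_sub_setIntegral_le (hab : a < b) (u : W12 a b) {x l r : ℝ}
    (hx : x ∈ Icc l r) (hl : a ≤ l) (hr : r ≤ b) :
    ‖(r - l : ℝ) * eval hab x ⟨hl.trans hx.1, hx.2.trans hr⟩ u - ∫ t in Ioo l r, (u : L2 a b) t‖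
      ≤ √(r - l) * ‖weakDeriv a b u‖ * (r - l) := by
  have hsub : Ioo l r ⊆ Ioo a b := Ioo_subset_Ioo hl hr
  have hvol : volume.real (Ioo l r) = r - l := by
    rw [Real.volume_real_Ioo_of_le (hx.1.trans hx.2)]
  have hint : IntegrableOn (fun t => (u : L2 a b) t) (Ioo l r) :=
    IntegrableOn.mono_set (integrable_coe (u : L2 a b)) hsub
  have hosc : ∀ᵐ t ∂(volume.restrict (Ioo l r)),
      ‖eval hab x ⟨hl.trans hx.1, hx.2.trans hr⟩ u - (u : L2 a b) t‖
        ≤ √(r - l) * ‖weakDeriv a b u‖ := by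
    filter_upwards [ae_restrict_of_ae_restrict_of_subset hsub (ae_eq_eval hab u),
      ae_restrict_mem measurableSet_Ioo] with t ht htI
    rw [ht (Ioo_subset_Icc_self (hsub htI))]
    refine (norm_eval_sub_le hab u _ _).trans ?_
    gcongr
    rw [abs_le]
    constructor <;> linarith [htI.1, htI.2, hx.1, hx.2]
  have h := norm_setIntegral_le_of_norm_le_const_ae (by simp) hosc
  rwa [integral_sub (integrable_const _) hint, setIntegral_const, Complex.real_smul, hvol] at h

theorem norm_eval_le (hab : a < b) (u : W12 a b) {x : ℝ} (hx : x ∈ Icc a b) {ε : ℝ} (hε : 0 < ε)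
    (hεab : ε ≤ b - a) :
    ‖eval hab x hx u‖ ≤ √ε * ‖weakDeriv a b u‖ + ‖(u : L2 a b)‖ / √ε := by
  obtain ⟨l, r, hl, hr, hxlr, rfl⟩ : ∃ l r, a ≤ l ∧ r ≤ b ∧ x ∈ Icc l r ∧ r - l = ε := by
    rcases le_or_gt (x + ε) b with h | h
    · exact ⟨x, x + ε, hx.1, h, ⟨le_rfl, by linarith⟩, by ring⟩
    · exact ⟨b - ε, b, by linarith, le_rfl, ⟨by linarith, hx.2⟩, by ring⟩
  refine le_of_mul_le_mul_left ?_ hε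
  calc (r - l) * ‖eval hab x hx u‖ = ‖(r - l : ℝ) * eval hab x hx u‖ := by
        rw [norm_mul, Complex.norm_real, Real.norm_of_nonneg hε.le]
    _ ≤ √(r - l) * ‖weakDeriv a b u‖ * (r - l) + √(r - l) * ‖(u : L2 a b)‖ :=
        (norm_le_norm_sub_add _ (∫ t in Ioo l r, (u : L2 a b) t)).trans <| add_le_add
          (norm_mul_eval_sub_setIntegral_le hab u hxlr hl hr)
          (norm_setIntegral_le _ hl (by linarith) hr)
    _ = (r - l) * (√(r - l) * ‖weakDeriv a b u‖ + ‖(u : L2 a b)‖ / √(r - l)) := by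
        rw [mul_add, mul_div_left_comm, Real.div_sqrt]
        ring

theorem norm_eval_sq_le (hab : a < b) (u : W12 a b) {x : ℝ} (hx : x ∈ Icc a b) {ε : ℝ}
    (hε : 0 < ε) (hεab : ε ≤ b - a) :
    ‖eval hab x hx u‖ ^ 2 ≤ 2 * ε * ‖weakDeriv a b u‖ ^ 2 + 2 / ε * ‖(u : L2 a b)‖ ^ 2 := by
  calc ‖eval hab x hx u‖ ^ 2 ≤ (√ε * ‖weakDeriv a b u‖ + ‖(u : L2 a b)‖ / √ε) ^ 2 := by
        gcongr; exact norm_eval_le hab u hx hε hεab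
    _ ≤ 2 * ((√ε * ‖weakDeriv a b u‖) ^ 2 + (‖(u : L2 a b)‖ / √ε) ^ 2) := add_sq_le
    _ = 2 * ε * ‖weakDeriv a b u‖ ^ 2 + 2 / ε * ‖(u : L2 a b)‖ ^ 2 := by
        rw [mul_pow, div_pow, Real.sq_sqrt hε.le]
        ring

theorem exists_norm_eval_sq_le (hab : a < b) {ε : ℝ} (hε : 0 < ε) :
    ∃ C, ∀ (u : W12 a b) (x : ℝ) (hx : x ∈ Icc a b),
      ‖eval hab x hx u‖ ^ 2 ≤ ε * ‖weakDeriv a b u‖ ^ 2 + C * ‖(u : L2 a b)‖ ^ 2 := by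
  have hpos : 0 < min (ε / 2) (b - a) := lt_min (half_pos hε) (sub_pos.2 hab)
  refine ⟨2 / min (ε / 2) (b - a), fun u x hx =>
    (norm_eval_sq_le hab u hx hpos (min_le_right _ _)).trans ?_⟩
  gcongr
  linarith [min_le_left (ε / 2) (b - a)]

theorem norm_eval_le_norm_jet (hab : a < b) (u : W12 a b) {x : ℝ} (hx : x ∈ Icc a b) :
    ‖eval hab x hx u‖ ≤ (√(b - a) + 1 / √(b - a)) * ‖jet a b u‖ := by
  have hfst : ‖(u : L2 a b)‖ ≤ ‖jet a b u‖ := norm_fst_le (jet a b u)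
  have hsnd : ‖weakDeriv a b u‖ ≤ ‖jet a b u‖ := norm_snd_le (jet a b u)
  calc ‖eval hab x hx u‖ ≤ √(b - a) * ‖weakDeriv a b u‖ + ‖(u : L2 a b)‖ / √(b - a) :=
        norm_eval_le hab u hx (sub_pos.2 hab) le_rfl
    _ ≤ √(b - a) * ‖jet a b u‖ + ‖jet a b u‖ / √(b - a) := by gcongr
    _ = (√(b - a) + 1 / √(b - a)) * ‖jet a b u‖ := by ring

theorem eval_eq_zero_of_mem_W120 (hab : a < b) {u : W12 a b} (hu : (u : L2 a b) ∈ W120 a b)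
    {x : ℝ} (hx : x ∈ Icc a b) (hx' : x ∉ Ioo a b) : eval hab x hx u = 0 := by
  obtain ⟨u', hmem, he⟩ := hu
  obtain rfl : u' = u := Subtype.ext he
  set S := {p | ‖eval hab x hx u'‖ ≤ (√(b - a) + 1 / √(b - a)) * ‖jet a b u' - p‖}
  have hS : IsClosed S := isClosed_le continuous_const (by fun_prop)
  have hle : jet a b u' ∈ S := by
    refine closure_minimal ?_ hS hmem
    rintro _ ⟨v, ⟨φ, hφ, hv⟩, rfl⟩
    have hvx : eval hab x hx v = 0 :=
      (eval_eq hab hx v hφ.contDiff.continuous.continuousOn hv).trans (hφ.eq_zero hx')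
    have hle := norm_eval_le_norm_jet hab (u' - v) hx
    rw [map_sub, map_sub, hvx, sub_zero] at hle
    exact hle
  simpa [S] using hle

theorem exists_weakDeriv_eq_deriv (hab : a < b) {φ : ℝ → ℂ} (hφ : IsTest a b φ) :
    ∃ v : W12 a b, (v : L2 a b) ∈ testSpace a b ∧ weakDeriv a b v = hφ.deriv.memLp.toLp _ := by
  obtain ⟨v, hv', hv⟩ := exists_primitive hab (hφ.deriv.memLp.toLp _) 0
  refine ⟨v, ⟨φ, hφ, ?_⟩, hv'⟩
  filter_upwards [ae_eq_eval hab v, ae_restrict_mem measurableSet_Ioo] with x hx hxI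
  have hprim : ∫ t in a..x, (hφ.deriv.memLp.toLp _ : L2 a b) t = ∫ t in a..x, deriv φ t := by
    rw [intervalIntegral.integral_of_le hxI.1.le, intervalIntegral.integral_of_le hxI.1.le,
      integral_Ioc_eq_integral_Ioo, integral_Ioc_eq_integral_Ioo]
    exact integral_congr_ae (ae_restrict_of_ae_restrict_of_subset
      (Ioo_subset_Ioo le_rfl hxI.2.le) hφ.deriv.memLp.coeFn_toLp)
  rw [hx (Ioo_subset_Icc_self hxI), hv, hprim, intervalIntegral.integral_deriv_eq_sub
    (fun t _ => (hφ.contDiff.differentiable (by simp)).differentiableAt)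
    (hφ.deriv.contDiff.continuous.intervalIntegrable _ _), hφ.eq_zero (x := a) (by simp),
    sub_zero, add_zero]

theorem inner_eq_zero_of_mem_orthogonal_weakDeriv_test (hab : a < b) {f g : L2 a b}
    (hf : f ∈ (((testSpace a b).comap (W12 a b).subtype).map (weakDeriv a b))ᗮ)
    (hg : ∫ x in Ioo a b, g x = 0) : inner ℂ f g = 0 := by
  have hconj : Integrable (fun x => starRingEnd ℂ (f x)) (volume.restrict (Ioo a b)) :=
    Complex.conjLIE.toContinuousLinearEquiv.toContinuousLinearMap.integrable_comp
      (integrable_coe f)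
  obtain ⟨c, hc⟩ := ae_eq_const_of_test hab hconj fun φ hφ => by
    obtain ⟨v, hv, hv'⟩ := exists_weakDeriv_eq_deriv hab hφ
    have horth := inner_eq_zero_symm.1
      ((Submodule.mem_orthogonal _ _).1 hf _ (Submodule.mem_map_of_mem hv))
    rw [← horth, hv', L2.inner_def]
    refine integral_congr_ae ?_
    filter_upwards [hφ.deriv.memLp.coeFn_toLp] with x hx
    rw [hx, RCLike.inner_apply, mul_comm]
  calc inner ℂ f g = ∫ x in Ioo a b, g x * c := by
        rw [L2.inner_def]
        refine integral_congr_ae ?_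
        filter_upwards [hc] with x hx
        rw [RCLike.inner_apply, hx]
    _ = 0 := by rw [integral_mul_const, hg, zero_mul]

theorem mem_closure_weakDeriv_test (hab : a < b) {g : L2 a b}
    (hg : ∫ x in Ioo a b, g x = 0) :
    g ∈ (((testSpace a b).comap (W12 a b).subtype).map (weakDeriv a b)).topologicalClosure := by
  rw [← Submodule.orthogonal_orthogonal_eq_closure]
  exact (Submodule.mem_orthogonal _ _).2 fun f hf =>
    inner_eq_zero_of_mem_orthogonal_weakDeriv_test hab hf hg

theorem mem_W120_of_eval_eq_zero (hab : a < b) {u : W12 a b}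
    (ha : eval hab a (left_mem_Icc.2 hab.le) u = 0)
    (hb : eval hab b (right_mem_Icc.2 hab.le) u = 0) : (u : L2 a b) ∈ W120 a b := by
  have hmean : ∫ x in Ioo a b, weakDeriv a b u x = 0 := by
    rw [← integral_Ioc_eq_integral_Ioo, ← intervalIntegral.integral_of_le hab.le]
    simpa only [ha, hb, add_zero] using (eval_eq_primitive hab u (right_mem_Icc.2 hab.le)).symm
  refine ⟨u, Metric.mem_closure_iff.2 fun ε hε => ?_, rfl⟩
  have hC : 0 < 1 + (b - a) := by linarith
  obtain ⟨_, ⟨v, hv, rfl⟩, hdist⟩ := Metric.mem_closure_iff.1 (mem_closure_weakDeriv_test hab hmean)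
    (ε / (1 + (b - a))) (by positivity)
  rw [dist_eq_norm, ← map_sub, lt_div_iff₀ hC] at hdist
  have hva : eval hab a (left_mem_Icc.2 hab.le) v = 0 :=
    eval_eq_zero_of_mem_W120 hab (testSpace_le_W120 hv) _ (by simp)
  have hpoincare : ‖((u - v : W12 a b) : L2 a b)‖ ≤ (b - a) * ‖weakDeriv a b (u - v)‖ :=
    norm_le_of_eval_left_eq_zero hab (by rw [map_sub, ha, hva, sub_zero])
  refine ⟨jet a b v, ⟨v, hv, rfl⟩, ?_⟩
  rw [dist_eq_norm, ← map_sub]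
  exact max_lt (hpoincare.trans_lt (by linarith [norm_nonneg (weakDeriv a b (u - v))]))
    ((le_mul_of_one_le_right (norm_nonneg _) (by linarith)).trans_lt hdist)

theorem exists_eval_eq (hab : a < b) (z w : ℂ) :
    ∃ u : W12 a b, eval hab a (left_mem_Icc.2 hab.le) u = z ∧
      eval hab b (right_mem_Icc.2 hab.le) u = w := by
  have hL : MemLp (fun _ : ℝ => (w - z) / (b - a : ℝ)) 2 (volume.restrict (Ioo a b)) :=
    memLp_of_continuousOn continuousOn_const
  obtain ⟨u, -, hu⟩ := exists_primitive hab (hL.toLp _) z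
  refine ⟨u, by simp [hu], ?_⟩
  have hba : ((b - a : ℝ) : ℂ) ≠ 0 := by exact_mod_cast (sub_pos.2 hab).ne'
  rw [hu, intervalIntegral.integral_of_le hab.le, integral_Ioc_eq_integral_Ioo,
    integral_congr_ae hL.coeFn_toLp, setIntegral_const, Real.volume_real_Ioo_of_le hab.le,
    Complex.real_smul, mul_div_cancel₀ _ hba, sub_add_cancel]

theorem not_finiteDimensional_L2 (hab : a < b) : ¬ FiniteDimensional ℂ (L2 a b) := by
  intro _
  have hcont (p : Polynomial ℂ) : Continuous fun x : ℝ => p.eval (x : ℂ) :=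
    p.continuous.comp Complex.continuous_ofReal
  have hL (p : Polynomial ℂ) : MemLp (fun x : ℝ => p.eval (x : ℂ)) 2
      (volume.restrict (Ioo a b)) := memLp_of_continuousOn (hcont p).continuousOn
  let F : Polynomial ℂ →ₗ[ℂ] L2 a b :=
    { toFun := fun p => (hL p).toLp _
      map_add' := fun p q => by
        rw [← MemLp.toLp_add]
        exact MemLp.toLp_congr _ _ (Eventually.of_forall fun x => by simp)
      map_smul' := fun c p => by
        rw [RingHom.id_apply, ← MemLp.toLp_const_smul]
        exact MemLp.toLp_congr _ _ (Eventually.of_forall fun x => by simp) }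
  have hF : Function.Injective F := by
    refine (injective_iff_map_eq_zero F).2 fun p hp => ?_
    have hae : (fun x : ℝ => p.eval (x : ℂ)) =ᵐ[volume.restrict (Ioo a b)] fun _ => 0 :=
      ((hL p).coeFn_toLp.symm.trans (by rw [show (hL p).toLp _ = 0 from hp])).trans
        (Lp.coeFn_zero _ _ _)
    have hzero := eqOn_of_ae_eq hab (hcont p).continuousOn continuousOn_const hae
    refine p.eq_zero_of_infinite_isRoot ?_
    refine ((Icc_infinite hab).image Complex.ofReal_injective.injOn).mono ?_
    rintro _ ⟨x, hx, rfl⟩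
    exact hzero hx
  exact Polynomial.not_finite (Module.Finite.of_injective F hF)

/-! ### The Sobolev Hilbert space and its compact embedding -/

theorem continuous_integral_mul_test {φ : ℝ → ℂ} (hφ : IsTest a b φ) :
    Continuous fun u : L2 a b => ∫ x in Ioo a b, u x * φ x := by
  have hconj : MemLp (fun x => starRingEnd ℂ (φ x)) 2 (volume.restrict (Ioo a b)) :=
    memLp_of_continuousOn (Complex.continuous_conj.comp hφ.contDiff.continuous).continuousOn
  have hinner : (fun u : L2 a b => ∫ x in Ioo a b, u x * φ x)
      = fun u => inner ℂ (hconj.toLp _) u := by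
    funext u
    rw [L2.inner_def]
    refine integral_congr_ae ?_
    filter_upwards [hconj.coeFn_toLp] with x hx
    rw [hx, RCLike.inner_apply, Complex.conj_conj]
  rw [hinner]
  fun_prop

theorem isClosed_hasWeakDeriv :
    IsClosed {p : WithLp 2 (L2 a b × L2 a b) | HasWeakDeriv p.fst p.snd} := by
  simp only [HasWeakDeriv, ofPred_forall]
  refine isClosed_iInter fun φ => isClosed_iInter fun hφ => ?_
  exact isClosed_eq ((continuous_integral_mul_test hφ.deriv).comp (WithLp.fstL 2 ℂ _ _).continuous)
    ((continuous_integral_mul_test hφ).comp (WithLp.sndL 2 ℂ _ _).continuous).neg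

/-- The pairs `(u, u')` with `u ∈ D ∩ W^{1,2}`, as a subspace of the Hilbert sum `L² ⊕ L²`: this is
`D` with the inner product of `W^{1,2}`. -/
def sobolevGraph (D : Submodule ℂ (L2 a b)) : Submodule ℂ (WithLp 2 (L2 a b × L2 a b)) where
  carrier := {p | p.fst ∈ D ∧ HasWeakDeriv p.fst p.snd}
  zero_mem' := ⟨D.zero_mem, HasWeakDeriv.zero⟩
  add_mem' hp hq := ⟨D.add_mem hp.1 hq.1, hp.2.add hq.2⟩
  smul_mem' c _ hp := ⟨D.smul_mem c hp.1, hp.2.smul c⟩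

theorem isClosed_sobolevGraph_W12 :
    IsClosed (sobolevGraph (W12 a b) : Set (WithLp 2 (L2 a b × L2 a b))) := by
  convert isClosed_hasWeakDeriv (a := a) (b := b) using 1
  ext p
  exact ⟨fun hp => hp.2, fun hp => ⟨⟨_, hp⟩, hp⟩⟩

theorem isClosed_sobolevGraph_W120 :
    IsClosed (sobolevGraph (W120 a b) : Set (WithLp 2 (L2 a b × L2 a b))) := by
  have hjets : IsClosed {p : WithLp 2 (L2 a b × L2 a b) | WithLp.ofLp p ∈
      (Submodule.map (jet a b) <| Submodule.comap (W12 a b).subtype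
        (testSpace a b)).topologicalClosure} :=
    (Submodule.isClosed_topologicalClosure _).preimage (WithLp.prod_continuous_ofLp 2 _ _)
  convert (isClosed_hasWeakDeriv (a := a) (b := b)).inter hjets using 1
  ext p
  have hjet (w : W12 a b) (hw : (w : L2 a b) = p.fst) (hp : HasWeakDeriv p.fst p.snd) :
      jet a b w = WithLp.ofLp p :=
    Prod.ext hw ((hasWeakDeriv_weakDeriv w).unique (hw ▸ hp))
  constructor
  · rintro ⟨⟨w, hw, hwp⟩, hp⟩
    refine ⟨hp, ?_⟩
    rw [mem_ofPred_eq, ← hjet w hwp hp]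
    exact hw
  · rintro ⟨hp, hp'⟩
    refine ⟨⟨⟨p.fst, _, hp⟩, ?_, rfl⟩, hp⟩
    rw [SetLike.mem_coe, Submodule.mem_comap, hjet ⟨p.fst, _, hp⟩ rfl hp]
    exact hp'

variable {D : Submodule ℂ (L2 a b)}

/-- The Sobolev function `u` underlying a point `(u, u')` of the graph. -/
def graphFun (D : Submodule ℂ (L2 a b)) : sobolevGraph D →ₗ[ℂ] W12 a b where
  toFun p := ⟨(p : WithLp 2 (L2 a b × L2 a b)).fst, _, p.2.2⟩
  map_add' _ _ := rfl
  map_smul' _ _ := rfl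

theorem jet_graphFun (p : sobolevGraph D) : jet a b (graphFun D p) = WithLp.ofLp p.1 :=
  Prod.ext rfl ((hasWeakDeriv_weakDeriv _).unique p.2.2)

theorem norm_jet_graphFun_le (p : sobolevGraph D) : ‖jet a b (graphFun D p)‖ ≤ ‖p‖ := by
  rw [jet_graphFun]
  exact max_le (WithLp.norm_fst_le _ p.1) (WithLp.norm_snd_le _ p.1)

theorem norm_sq_graph (p : sobolevGraph D) :
    ‖p‖ ^ 2 = ‖(graphFun D p : L2 a b)‖ ^ 2 + ‖weakDeriv a b (graphFun D p)‖ ^ 2 := by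
  rw [show weakDeriv a b (graphFun D p) = p.1.snd from congrArg Prod.snd (jet_graphFun p)]
  exact WithLp.prod_norm_sq_eq_of_L2 p.1

/-- The embedding `(u, u') ↦ u` of the Sobolev Hilbert space into `L²`. -/
noncomputable def graphEmb (D : Submodule ℂ (L2 a b)) : sobolevGraph D →L[ℂ] L2 a b :=
  LinearMap.mkContinuous ((W12 a b).subtype.comp (graphFun D)) 1 fun p => by
    rw [one_mul]; exact (norm_fst_le (jet a b (graphFun D p))).trans (norm_jet_graphFun_le p)

/-- The derivative `(u, u') ↦ u'` on the Sobolev Hilbert space. -/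
noncomputable def graphDeriv (D : Submodule ℂ (L2 a b)) : sobolevGraph D →L[ℂ] L2 a b :=
  LinearMap.mkContinuous ((weakDeriv a b).comp (graphFun D)) 1 fun p => by
    rw [one_mul]; exact (norm_snd_le (jet a b (graphFun D p))).trans (norm_jet_graphFun_le p)

/-- The point evaluation `(u, u') ↦ u(x)` on the Sobolev Hilbert space. -/
noncomputable def graphEval (D : Submodule ℂ (L2 a b)) (hab : a < b) (x : ℝ) (hx : x ∈ Icc a b) :
    sobolevGraph D →L[ℂ] ℂ :=
  LinearMap.mkContinuous ((eval hab x hx).comp (graphFun D)) (√(b - a) + 1 / √(b - a)) fun p =>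
    (norm_eval_le_norm_jet hab _ hx).trans (by gcongr; exact norm_jet_graphFun_le p)

theorem graphDeriv_apply (p : sobolevGraph D) :
    graphDeriv D p = weakDeriv a b (graphFun D p) := rfl

theorem graphEval_apply (hab : a < b) {x : ℝ} (hx : x ∈ Icc a b) (p : sobolevGraph D) :
    graphEval D hab x hx p = eval hab x hx (graphFun D p) := rfl

theorem isCompactOperator_graphEmb (hab : a < b)
    (hD : IsClosed (sobolevGraph D : Set (WithLp 2 (L2 a b × L2 a b)))) :
    IsCompactOperator (graphEmb D) := by
  have : CompleteSpace (sobolevGraph D) := hD.completeSpace_coe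
  have hL : 0 < b - a := sub_pos.2 hab
  refine UnboundedOp.isCompactOperator_of_forall_exists_finite _ fun ε hε => ?_
  -- `u` vanishing on a `d`-net satisfies `‖u‖ ≤ √(b - a) √d ‖u'‖`, and `√(b - a) √d = ε`.
  obtain ⟨t, htI, htfin, hcover⟩ :=
    finite_cover_balls_of_compact (isCompact_Icc (a := a) (b := b)) (e := ε ^ 2 / (b - a))
      (by positivity)
  have : Finite t := htfin
  refine ⟨range fun y : t => graphEval D hab y (htI y.2), finite_range _, fun p hp => ?_⟩
  have hsmall := norm_le_of_forall_exists_eval_eq_zero hab (u := graphFun D p)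
    (d := ε ^ 2 / (b - a)) fun x hx => by
      obtain ⟨y, hyt, hxy⟩ := mem_iUnion₂.1 (hcover hx)
      exact ⟨y, htI hyt, (Metric.mem_ball.1 hxy).le, hp _ (mem_range_self (⟨y, hyt⟩ : t))⟩
  calc ‖graphEmb D p‖
      ≤ √(b - a) * (√(ε ^ 2 / (b - a)) * ‖weakDeriv a b (graphFun D p)‖) := hsmall
    _ = ε * ‖weakDeriv a b (graphFun D p)‖ := by
        rw [← mul_assoc, ← Real.sqrt_mul hL.le, mul_div_cancel₀ _ hL.ne', Real.sqrt_sq hε.le]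
    _ ≤ ε * ‖p‖ := by
        gcongr
        exact (norm_snd_le (jet a b (graphFun D p))).trans (norm_jet_graphFun_le p)

end IntervalSobolev

/-! ### Forms with a δ-interaction -/

namespace DeltaInteraction

open UnboundedOp IntervalSobolev

variable {xm xp : ℝ}

theorem deltaExpr_apply (hx : xm < xp) (α : ℝ) (u v : W12 xm xp) :
    deltaExpr hx α u v = inner ℂ (weakDeriv xm xp v) (weakDeriv xm xp u)
      + α * (eval hx _ (mid_mem hx) u * starRingEnd ℂ (eval hx _ (mid_mem hx) v)) := rfl

theorem robinExpr_apply (hx : xm < xp) (α βm βp : ℝ) (u v : W12 xm xp) :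
    robinExpr hx α βm βp u v = deltaExpr hx α u v
      + 1 / 2 * (βm * (eval hx xm (left_mem hx) u * starRingEnd ℂ (eval hx xm (left_mem hx) v))
        + βp * (eval hx xp (right_mem hx) u * starRingEnd ℂ (eval hx xp (right_mem hx) v))) := rfl

theorem deltaExpr_self_re (hx : xm < xp) (α : ℝ) (u : W12 xm xp) :
    (deltaExpr hx α u u).re
      = ‖weakDeriv xm xp u‖ ^ 2 + α * ‖eval hx _ (mid_mem hx) u‖ ^ 2 := by
  rw [deltaExpr_apply, Complex.mul_conj', Complex.add_re, re_inner_self, ← Complex.ofReal_pow,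
    Complex.re_ofReal_mul, Complex.ofReal_re]

theorem robinExpr_self_re (hx : xm < xp) (α βm βp : ℝ) (u : W12 xm xp) :
    (robinExpr hx α βm βp u u).re = (deltaExpr hx α u u).re
      + 1 / 2 * (βm * ‖eval hx xm (left_mem hx) u‖ ^ 2
        + βp * ‖eval hx xp (right_mem hx) u‖ ^ 2) := by
  rw [robinExpr_apply, Complex.mul_conj', Complex.mul_conj', Complex.add_re]
  congr 1
  rw [← Complex.ofReal_re (1 / 2 * _)]
  push_cast
  rfl

theorem robinExpr_zero (hx : xm < xp) (α : ℝ) : robinExpr hx α 0 0 = deltaExpr hx α := by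
  ext u v
  simp [robinExpr_apply]

theorem exists_coercive (hx : xm < xp) (α βm βp : ℝ) :
    ∃ c : ℝ, ∀ u : W12 xm xp, 1 / 2 * (‖(u : L2 xm xp)‖ ^ 2 + ‖weakDeriv xm xp u‖ ^ 2)
      ≤ shiftedEnergy (robinExpr hx α βm βp) c u := by
  set M := |α| + 1 / 2 * |βm| + 1 / 2 * |βp| + 1 with hMdef
  have hM : 0 < M := by positivity
  obtain ⟨C, hC⟩ := exists_norm_eval_sq_le hx (ε := 1 / (2 * M)) (by positivity)
  refine ⟨1 / 2 + M * C, fun u => ?_⟩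
  set n := ‖(u : L2 xm xp)‖ ^ 2
  set d := ‖weakDeriv xm xp u‖ ^ 2
  have hγ : ∀ (γ x : ℝ) (hxI : x ∈ Icc xm xp),
      -(|γ| * (1 / (2 * M) * d + C * n)) ≤ γ * ‖eval hx x hxI u‖ ^ 2 := fun γ x hxI =>
    neg_le_of_abs_le <| by
      rw [abs_mul, abs_of_nonneg (sq_nonneg ‖eval hx x hxI u‖)]
      gcongr
      exact hC u x hxI
  have hbound : 0 ≤ 1 / (2 * M) * d + C * n := (sq_nonneg _).trans (hC u xm (left_mem hx))
  have hsum : M * (1 / (2 * M) * d + C * n) = 1 / 2 * d + M * C * n := by field_simp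
  rw [shiftedEnergy, robinExpr_self_re, deltaExpr_self_re]
  nlinarith [hγ α _ (mid_mem hx), hγ βm _ (left_mem hx), hγ βp _ (right_mem hx)]

theorem exists_hasCompactResolvent_of_isClosed_sobolevGraph (hx : xm < xp) (α βm βp : ℝ)
    (h : DenseForm (L2 xm xp)) (hle : h.domain ≤ W12 xm xp)
    (hcl : IsClosed (sobolevGraph h.domain : Set (WithLp 2 (L2 xm xp × L2 xm xp))))
    (hform : ∀ u v, h.form u v
      = robinExpr hx α βm βp (Submodule.inclusion hle u) (Submodule.inclusion hle v)) :
    ∃ c K, h.HasCompactResolvent c K := by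
  have : CompleteSpace (sobolevGraph h.domain) := hcl.completeSpace_coe
  obtain ⟨c, hc⟩ := exists_coercive hx α βm βp
  obtain ⟨T, hTs, hT⟩ := exists_isSymmetric_of_form (graphDeriv h.domain)
    ![graphEval h.domain hx _ (mid_mem hx), graphEval h.domain hx _ (left_mem hx),
      graphEval h.domain hx _ (right_mem hx)] ![α, 1 / 2 * βm, 1 / 2 * βp]
  have hTform : ∀ p q, inner ℂ q (T p)
      = robinExpr hx α βm βp (graphFun h.domain p) (graphFun h.domain q) := by
    intro p q
    rw [hT, Fin.sum_univ_three, robinExpr_apply, deltaExpr_apply]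
    simp only [Matrix.cons_val, graphDeriv_apply, graphEval_apply]
    push_cast
    ring
  refine ⟨c, h.exists_hasCompactResolvent (isCompactOperator_graphEmb hx hcl) (fun p => p.2.1)
    (fun w => ?_) hTs (fun p q => ?_) one_half_pos fun p => ?_⟩
  · exact ⟨⟨WithLp.toLp 2 ((w : L2 xm xp), weakDeriv xm xp ⟨w, hle w.2⟩),
      w.2, hasWeakDeriv_weakDeriv ⟨w, hle w.2⟩⟩, rfl⟩
  · rw [hTform, hform]
    rfl
  · rw [hTform, norm_sq_graph]
    exact hc (graphFun h.domain p)

theorem exists_hasCompactResolvent_robinForm (hx : xm < xp) (α βm βp : ℝ) :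
    ∃ c K, (robinForm hx α βm βp).HasCompactResolvent c K :=
  exists_hasCompactResolvent_of_isClosed_sobolevGraph hx α βm βp _ le_rfl
    isClosed_sobolevGraph_W12 fun _ _ => rfl

theorem exists_hasCompactResolvent_dirichletForm (hx : xm < xp) (α : ℝ) :
    ∃ c K, (dirichletForm hx α).HasCompactResolvent c K :=
  exists_hasCompactResolvent_of_isClosed_sobolevGraph hx α 0 0 _ W120_le_W12
    isClosed_sobolevGraph_W120 fun u v => by rw [robinExpr_zero]; rfl

/-- The squared norm `|u(x₋)|² + |u(x₊)|²` of the boundary values of `u`. -/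
noncomputable def boundaryNormSq (hx : xm < xp) (u : W12 xm xp) : ℝ :=
  ‖eval hx xm (left_mem hx) u‖ ^ 2 + ‖eval hx xp (right_mem hx) u‖ ^ 2

theorem boundaryNormSq_nonneg (hx : xm < xp) (u : W12 xm xp) : 0 ≤ boundaryNormSq hx u := by
  unfold boundaryNormSq
  positivity

theorem shiftedEnergy_deltaExpr_add_le (hx : xm < xp) (α c : ℝ) {βm βp B : ℝ}
    (hB : B ≤ min βm βp) (u : W12 xm xp) :
    shiftedEnergy (deltaExpr hx α) c u + B / 2 * boundaryNormSq hx u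
      ≤ shiftedEnergy (robinExpr hx α βm βp) c u := by
  have hm := mul_le_mul_of_nonneg_right (hB.trans (min_le_left _ _))
    (sq_nonneg ‖eval hx xm (left_mem hx) u‖)
  have hp := mul_le_mul_of_nonneg_right (hB.trans (min_le_right _ _))
    (sq_nonneg ‖eval hx xp (right_mem hx) u‖)
  rw [shiftedEnergy, shiftedEnergy, robinExpr_self_re, boundaryNormSq]
  linarith

end DeltaInteraction

/-! ### Robin eigenvalues for large boundary parameters -/

theorem tendsto_sInf_of_eventually_shift_mem {ι : Type*} {l : Filter ι} {S : ι → Set ℝ}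
    {S₀ : Set ℝ} {c : ℝ} (hne : S₀.Nonempty) (hsub : ∀ i, S₀ ⊆ S i)
    (hbdd : ∀ᶠ i in l, ∀ t ∈ S i, -c ≤ t)
    (hshift : ∀ r > 1, ∀ s, ∀ᶠ i in l, ∀ t ∈ S i, t ≤ s → r * (t + c) - c ∈ S₀) :
    Tendsto (fun i => sInf (S i)) l (𝓝 (sInf S₀)) := by
  obtain ⟨s, hs⟩ := hne
  rcases l.eq_or_neBot with rfl | _
  · exact tendsto_bot
  obtain ⟨i₀, hi₀⟩ := hbdd.exists
  have hbdd₀ : BddBelow S₀ := ⟨-c, fun t ht => hi₀ t (hsub i₀ ht)⟩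
  have hlower : ∀ r > 1, ∀ᶠ i in l, (sInf S₀ + c) / r - c ≤ sInf (S i) := by
    intro r hr
    filter_upwards [hshift r hr s] with i hri
    refine le_csInf ⟨s, hsub i hs⟩ fun t ht => ?_
    have hmin : min t s ∈ S i := by
      rcases min_choice t s with h | h <;> rw [h]
      exacts [ht, hsub i hs]
    have hle := csInf_le hbdd₀ (hri _ hmin (min_le_right t s))
    rw [sub_le_iff_le_add, div_le_iff₀ (by linarith)]
    nlinarith [min_le_left t s]
  have hlim : Tendsto (fun r : ℝ => (sInf S₀ + c) / r - c) (𝓝[>] 1) (𝓝 (sInf S₀)) := by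
    have hcont : ContinuousAt (fun r : ℝ => (sInf S₀ + c) / r - c) 1 := by fun_prop (disch := simp)
    simpa using hcont.continuousWithinAt.tendsto (s := Ioi 1)
  refine tendsto_order.2 ⟨fun b hb => ?_, fun b hb => ?_⟩
  · obtain ⟨r, hbr, hr⟩ :=
      ((hlim.eventually (lt_mem_nhds hb)).and self_mem_nhdsWithin).exists
    filter_upwards [hlower r hr] with i using hbr.trans_le
  · filter_upwards [hbdd] with i hi
    exact (csInf_le_csInf ⟨-c, hi⟩ ⟨s, hs⟩ (hsub i)).trans_lt hb

namespace DeltaInteraction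

open UnboundedOp IntervalSobolev

variable {xm xp : ℝ}

theorem exists_boundary_correction (hx : xm < xp) {α c : ℝ}
    (hc : ∀ u, 0 ≤ shiftedEnergy (deltaExpr hx α) c u) :
    ∃ (R : W12 xm xp →ₗ[ℂ] W12 xm xp) (C : ℝ), 0 ≤ C ∧ ∀ u,
      ((u - R u : W12 xm xp) : L2 xm xp) ∈ W120 xm xp ∧
      shiftedEnergy (deltaExpr hx α) c (R u) ≤ C * boundaryNormSq hx u ∧
      ‖(R u : L2 xm xp)‖ ^ 2 ≤ C * boundaryNormSq hx u := by
  obtain ⟨em, hmm, hmp⟩ := exists_eval_eq hx 1 0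
  obtain ⟨ep, hpm, hpp⟩ := exists_eval_eq hx 0 1
  let R : W12 xm xp →ₗ[ℂ] W12 xm xp :=
    (eval hx xm (left_mem hx)).smulRight em + (eval hx xp (right_mem hx)).smulRight ep
  have hR : ∀ u, R u = eval hx xm (left_mem hx) u • em + eval hx xp (right_mem hx) u • ep :=
    fun u => rfl
  refine ⟨R, max (2 * (shiftedEnergy (deltaExpr hx α) c em + shiftedEnergy (deltaExpr hx α) c ep))
    (2 * (‖(em : L2 xm xp)‖ ^ 2 + ‖(ep : L2 xm xp)‖ ^ 2)),
    le_max_of_le_right (by positivity), fun u => ⟨?_, ?_, ?_⟩⟩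
  · refine mem_W120_of_eval_eq_zero hx ?_ ?_
    · simp [hR, hmm, hpm]
    · simp [hR, hmp, hpp]
  · rw [hR]
    exact (shiftedEnergy_smul_add_smul_le hc _ _ em ep).trans
      (mul_le_mul_of_nonneg_right (le_max_left _ _) (boundaryNormSq_nonneg hx u))
  · have hnorm := shiftedEnergy_smul_add_smul_le (B := (0 : W12 xm xp →ₗ[ℂ] _)) (c := 1)
      (fun u => by rw [shiftedEnergy_zero_one]; positivity)
      (eval hx xm (left_mem hx) u) (eval hx xp (right_mem hx) u) em ep
    simp only [shiftedEnergy_zero_one] at hnorm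
    rw [hR]
    exact hnorm.trans
      (mul_le_mul_of_nonneg_right (le_max_right _ _) (boundaryNormSq_nonneg hx u))

theorem one_sub_mul_norm_sq_le {H : Type*} [NormedAddCommGroup H] [InnerProductSpace ℂ H]
    {D : Submodule ℂ H} {u v : D} {δ : ℝ} (hδ : 0 < δ)
    (hv : (1 + δ⁻¹) * ‖(v : H)‖ ^ 2 ≤ δ * ‖(u : H)‖ ^ 2) :
    (1 - δ) * ‖(u : H)‖ ^ 2 ≤ (1 + δ) * ‖((u - v : D) : H)‖ ^ 2 := by
  have h := shiftedEnergy_add_le (B := (0 : D →ₗ[ℂ] D →ₛₗ[starRingEnd ℂ] ℂ)) (c := 1)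
    (fun u => by rw [shiftedEnergy_zero_one]; positivity) hδ (u - v) v
  simp only [shiftedEnergy_zero_one, sub_add_cancel] at h
  linarith

theorem shiftedEnergy_deltaExpr_add_le_mul (hx : xm < xp) {α βm βp t : ℝ} (c : ℝ) {u : W12 xm xp}
    (hu : (robinExpr hx α βm βp u u).re ≤ t * ‖(u : L2 xm xp)‖ ^ 2) :
    shiftedEnergy (deltaExpr hx α) c u + min βm βp / 2 * boundaryNormSq hx u
      ≤ (t + c) * ‖(u : L2 xm xp)‖ ^ 2 := by
  refine (shiftedEnergy_deltaExpr_add_le hx α c le_rfl u).trans ?_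
  rw [shiftedEnergy]
  linarith

theorem eventually_mul_boundaryNormSq_le (hx : xm < xp) {α c : ℝ}
    (hc : ∀ u, 0 ≤ shiftedEnergy (deltaExpr hx α) c u) {k δ : ℝ} (hk : 0 ≤ k) (hδ : 0 < δ)
    (s : ℝ) :
    ∀ᶠ β in comap (fun β : ℝ × ℝ => min β.1 β.2) atTop, ∀ u : W12 xm xp,
      (robinExpr hx α β.1 β.2 u u).re ≤ s * ‖(u : L2 xm xp)‖ ^ 2 →
        k * boundaryNormSq hx u ≤ δ * ‖(u : L2 xm xp)‖ ^ 2 := by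
  filter_upwards [tendsto_comap.eventually (eventually_gt_atTop 0),
    tendsto_comap.eventually (eventually_ge_atTop (2 * (k * (s + c)) / δ))] with β hpos hlarge u hu
  rw [div_le_iff₀ hδ] at hlarge
  have hboundary : min β.1 β.2 / 2 * boundaryNormSq hx u ≤ (s + c) * ‖(u : L2 xm xp)‖ ^ 2 := by
    linarith [hc u, shiftedEnergy_deltaExpr_add_le_mul hx c hu]
  refine le_of_mul_le_mul_left ?_ (half_pos hpos)
  calc min β.1 β.2 / 2 * (k * boundaryNormSq hx u)
      = k * (min β.1 β.2 / 2 * boundaryNormSq hx u) := by ring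
    _ ≤ k * ((s + c) * ‖(u : L2 xm xp)‖ ^ 2) := by gcongr
    _ = k * (s + c) * ‖(u : L2 xm xp)‖ ^ 2 := by ring
    _ ≤ min β.1 β.2 / 2 * δ * ‖(u : L2 xm xp)‖ ^ 2 := by gcongr ?_ * _; linarith
    _ = min β.1 β.2 / 2 * (δ * ‖(u : L2 xm xp)‖ ^ 2) := by ring

theorem shiftedEnergy_sub_le_mul (hx : xm < xp) {α c : ℝ}
    (hc : ∀ u, 0 ≤ shiftedEnergy (deltaExpr hx α) c u) {βm βp t C δ : ℝ} (hδ : 0 < δ)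
    {u v : W12 xm xp} (hC : (1 + δ⁻¹) * C ≤ min βm βp / 2)
    (hv : shiftedEnergy (deltaExpr hx α) c v ≤ C * boundaryNormSq hx u)
    (hu : (robinExpr hx α βm βp u u).re ≤ t * ‖(u : L2 xm xp)‖ ^ 2)
    (hβ : 0 ≤ min βm βp) :
    shiftedEnergy (deltaExpr hx α) c (u - v) ≤ (1 + δ) * ((t + c) * ‖(u : L2 xm xp)‖ ^ 2) := by
  have hS := boundaryNormSq_nonneg hx u
  calc shiftedEnergy (deltaExpr hx α) c (u - v)
      ≤ (1 + δ) * shiftedEnergy (deltaExpr hx α) c u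
        + (1 + δ⁻¹) * shiftedEnergy (deltaExpr hx α) c v := shiftedEnergy_sub_le hc hδ u v
    _ ≤ (1 + δ) * shiftedEnergy (deltaExpr hx α) c u
        + (1 + δ⁻¹) * (C * boundaryNormSq hx u) := by gcongr
    _ = (1 + δ) * shiftedEnergy (deltaExpr hx α) c u
        + (1 + δ⁻¹) * C * boundaryNormSq hx u := by ring
    _ ≤ (1 + δ) * shiftedEnergy (deltaExpr hx α) c u
        + min βm βp / 2 * boundaryNormSq hx u := by gcongr
    _ ≤ (1 + δ) * (shiftedEnergy (deltaExpr hx α) c u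
        + min βm βp / 2 * boundaryNormSq hx u) := by
        have : 0 ≤ δ * (min βm βp / 2 * boundaryNormSq hx u) := by positivity
        linarith
    _ ≤ (1 + δ) * ((t + c) * ‖(u : L2 xm xp)‖ ^ 2) := by
        gcongr; exact shiftedEnergy_deltaExpr_add_le_mul hx c hu

theorem exists_one_add_sq_le {r : ℝ} (hr : 1 < r) :
    ∃ δ : ℝ, 0 < δ ∧ δ < 1 ∧ (1 + δ) ^ 2 ≤ r * (1 - δ) := by
  have hcont : ContinuousAt (fun δ : ℝ => r * (1 - δ) - (1 + δ) ^ 2) 0 := by fun_prop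
  have hpos := hcont.eventually (lt_mem_nhds (by simpa using hr : (0 : ℝ) < _))
  obtain ⟨δ, hle, hδ, hδ1⟩ :=
    ((hpos.filter_mono nhdsWithin_le_nhds).and (Ioo_mem_nhdsGT (zero_lt_one' ℝ))).exists
  exact ⟨δ, hδ, hδ1, by linarith⟩

theorem le_mul_of_distortion {δ r M E x y : ℝ} (hδ : 0 ≤ δ) (hδ1 : δ < 1)
    (hr : (1 + δ) ^ 2 ≤ r * (1 - δ)) (hM : 0 ≤ M) (hy : 0 ≤ y) (hxy : (1 - δ) * x ≤ (1 + δ) * y)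
    (hE : E ≤ (1 + δ) * (M * x)) : E ≤ r * (M * y) := by
  have hδ' : 0 < 1 - δ := sub_pos.2 hδ1
  refine le_of_mul_le_mul_left ?_ hδ'
  calc (1 - δ) * E ≤ (1 - δ) * ((1 + δ) * (M * x)) := by gcongr
    _ = (1 + δ) * (M * ((1 - δ) * x)) := by ring
    _ ≤ (1 + δ) * (M * ((1 + δ) * y)) := by gcongr
    _ = (1 + δ) ^ 2 * (M * y) := by ring
    _ ≤ r * (1 - δ) * (M * y) := by gcongr
    _ = (1 - δ) * (r * (M * y)) := by ring

theorem shiftedEnergy_robinExpr_nonneg (hx : xm < xp) {α c : ℝ}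
    (hc : ∀ u, 0 ≤ shiftedEnergy (deltaExpr hx α) c u) {βm βp : ℝ} (hβ : 0 ≤ min βm βp)
    (u : W12 xm xp) : 0 ≤ shiftedEnergy (robinExpr hx α βm βp) c u := by
  have h := shiftedEnergy_deltaExpr_add_le hx α c hβ u
  rw [zero_div, zero_mul, add_zero] at h
  exact (hc u).trans h

theorem robinExpr_self_re_of_mem_W120 (hx : xm < xp) (α βm βp : ℝ) {u : W12 xm xp}
    (hu : (u : L2 xm xp) ∈ W120 xm xp) :
    (robinExpr hx α βm βp u u).re = (deltaExpr hx α u u).re := by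
  rw [robinExpr_self_re, eval_eq_zero_of_mem_W120 hx hu _ left_notMem_Ioo,
    eval_eq_zero_of_mem_W120 hx hu _ right_notMem_Ioo]
  simp

theorem trialValues_dirichletForm_subset (hx : xm < xp) (α βm βp : ℝ) (j : ℕ) :
    (dirichletForm hx α).trialValues j ⊆ (robinForm hx α βm βp).trialValues j := by
  intro t ht
  refine DenseForm.mem_trialValues_of_map (k := robinForm hx α βm βp)
    (Submodule.inclusion W120_le_W12) (fun u _ hu => ?_) (fun u hu => ?_) ht
  · exact Submodule.inclusion_injective W120_le_W12 (hu.trans (map_zero _).symm)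
  · exact (robinExpr_self_re_of_mem_W120 hx α βm βp
      (u := Submodule.inclusion W120_le_W12 u) u.2).trans_le hu

/-- A correction `R` that distorts norms and energies by factors close to `1` maps Robin trial
spaces to Dirichlet trial spaces. -/
theorem mem_trialValues_dirichletForm_of_correction (hx : xm < xp) {α βm βp c r δ t : ℝ}
    (R : W12 xm xp →ₗ[ℂ] W12 xm xp)
    (hR : ∀ u, ((u - R u : W12 xm xp) : L2 xm xp) ∈ W120 xm xp)
    (hδ : 0 < δ) (hδ1 : δ < 1) (hr : (1 + δ) ^ 2 ≤ r * (1 - δ)) (htc : -c ≤ t)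
    (hnorm : ∀ u : W12 xm xp, (robinExpr hx α βm βp u u).re ≤ t * ‖(u : L2 xm xp)‖ ^ 2 →
      (1 - δ) * ‖(u : L2 xm xp)‖ ^ 2 ≤ (1 + δ) * ‖((u - R u : W12 xm xp) : L2 xm xp)‖ ^ 2)
    (henergy : ∀ u : W12 xm xp, (robinExpr hx α βm βp u u).re ≤ t * ‖(u : L2 xm xp)‖ ^ 2 →
      shiftedEnergy (deltaExpr hx α) c (u - R u) ≤ (1 + δ) * ((t + c) * ‖(u : L2 xm xp)‖ ^ 2))
    {j : ℕ} (ht : t ∈ (robinForm hx α βm βp).trialValues j) :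
    r * (t + c) - c ∈ (dirichletForm hx α).trialValues j := by
  let P : W12 xm xp →ₗ[ℂ] W120 xm xp :=
    ((W12 xm xp).subtype.comp (LinearMap.id - R)).codRestrict (W120 xm xp) hR
  refine DenseForm.mem_trialValues_of_map (k := dirichletForm hx α) P
    (fun (u : W12 xm xp) hu hPu => ?_) (fun (u : W12 xm xp) hu => ?_) ht
  · have hzero : ((u - R u : W12 xm xp) : L2 xm xp) = 0 := congrArg Subtype.val hPu
    have h := hnorm u hu
    rw [hzero, norm_zero, zero_pow two_ne_zero, mul_zero] at h
    exact Subtype.ext (by simpa using nonpos_of_mul_nonpos_right h (sub_pos.2 hδ1))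
  · change (deltaExpr hx α (u - R u) (u - R u)).re
      ≤ _ * ‖((u - R u : W12 xm xp) : L2 xm xp)‖ ^ 2
    have hmul := le_mul_of_distortion hδ.le hδ1 hr (by linarith) (sq_nonneg _) (hnorm u hu)
      (henergy u hu)
    rw [shiftedEnergy] at hmul
    linarith

theorem eventually_mem_trialValues_dirichletForm (hx : xm < xp) {α c : ℝ}
    (hc : ∀ u, 0 ≤ shiftedEnergy (deltaExpr hx α) c u) {r : ℝ} (hr : 1 < r) (s : ℝ) {j : ℕ}
    (hj : 1 ≤ j) :
    ∀ᶠ β in comap (fun β : ℝ × ℝ => min β.1 β.2) atTop,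
      ∀ t ∈ (robinForm hx α β.1 β.2).trialValues j, t ≤ s →
        r * (t + c) - c ∈ (dirichletForm hx α).trialValues j := by
  obtain ⟨R, C, hC, hR⟩ := exists_boundary_correction hx hc
  obtain ⟨δ, hδ, hδ1, hδr⟩ := exists_one_add_sq_le hr
  filter_upwards [tendsto_comap.eventually (eventually_ge_atTop 0),
    tendsto_comap.eventually (eventually_ge_atTop (2 * ((1 + δ⁻¹) * C))),
    eventually_mul_boundaryNormSq_le hx hc (k := (1 + δ⁻¹) * C) (by positivity) hδ s]
    with β hβ hlarge hsmall t ht hts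
  refine mem_trialValues_dirichletForm_of_correction hx R (fun u => (hR u).1) hδ hδ1 hδr
    (DenseForm.neg_le_of_mem_trialValues (shiftedEnergy_robinExpr_nonneg hx hc hβ) hj ht)
    (fun u hu => one_sub_mul_norm_sq_le hδ ?_) (fun u hu => ?_) ht
  · calc (1 + δ⁻¹) * ‖(R u : L2 xm xp)‖ ^ 2
        ≤ (1 + δ⁻¹) * (C * boundaryNormSq hx u) := by gcongr; exact (hR u).2.2
      _ = (1 + δ⁻¹) * C * boundaryNormSq hx u := by ring
      _ ≤ δ * ‖(u : L2 xm xp)‖ ^ 2 := hsmall u (hu.trans (by gcongr))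
  · exact shiftedEnergy_sub_le_mul hx hc hδ (by linarith) (hR u).2.1 hu hβ

theorem tendsto_nthEigenvalue_robinOp (hx : xm < xp) (α : ℝ) {j : ℕ} (hj : 1 ≤ j) :
    Tendsto (fun β : ℝ × ℝ => nthEigenvalue (robinOp hx α β.1 β.2) j)
      (comap (fun β : ℝ × ℝ => min β.1 β.2) atTop)
      (𝓝 (nthEigenvalue (dirichletOp hx α) j)) := by
  have hinf := not_finiteDimensional_L2 hx
  obtain ⟨_, _, hD⟩ := exists_hasCompactResolvent_dirichletForm hx α
  have hrobin : ∀ β : ℝ × ℝ, nthEigenvalue (robinOp hx α β.1 β.2) j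
      = sInf ((robinForm hx α β.1 β.2).trialValues j) := fun β => by
    obtain ⟨_, _, hK⟩ := exists_hasCompactResolvent_robinForm hx α β.1 β.2
    exact hK.nthEigenvalue_eq_sInf_trialValues hinf hj
  obtain ⟨c, hc⟩ := exists_coercive hx α 0 0
  rw [robinExpr_zero] at hc
  have hnonneg : ∀ u, 0 ≤ shiftedEnergy (deltaExpr hx α) c u := fun u =>
    le_trans (by positivity) (hc u)
  simp only [hrobin, dirichletOp, hD.nthEigenvalue_eq_sInf_trialValues hinf hj]
  refine tendsto_sInf_of_eventually_shift_mem (c := c) (hD.trialValues_nonempty hinf j)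
    (fun β => trialValues_dirichletForm_subset hx α β.1 β.2 j) ?_
    fun r hr s => eventually_mem_trialValues_dirichletForm hx hnonneg hr s hj
  filter_upwards [tendsto_comap.eventually (eventually_ge_atTop 0)] with β hβ t ht
  exact DenseForm.neg_le_of_mem_trialValues (shiftedEnergy_robinExpr_nonneg hx hnonneg hβ) hj ht

end DeltaInteraction

theorem proposition2p6 (xm xp : ℝ) (hx : xm < xp) (α : ℝ) :
    (IsSelfAdjoint (DeltaInteraction.dirichletOp hx α) ∧
      UnboundedOp.HasPurelyDiscreteSpectrum (DeltaInteraction.dirichletOp hx α)) ∧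
    (∀ βm βp : ℝ, IsSelfAdjoint (DeltaInteraction.robinOp hx α βm βp) ∧
      UnboundedOp.HasPurelyDiscreteSpectrum (DeltaInteraction.robinOp hx α βm βp)) ∧
    ∀ j : ℕ, 1 ≤ j →
      Filter.Tendsto
        (fun β : ℝ × ℝ =>
          UnboundedOp.nthEigenvalue (DeltaInteraction.robinOp hx α β.1 β.2) j)
        (Filter.comap (fun β : ℝ × ℝ => min β.1 β.2) Filter.atTop)
        (nhds (UnboundedOp.nthEigenvalue (DeltaInteraction.dirichletOp hx α) j)) := by
  have hinf := IntervalSobolev.not_finiteDimensional_L2 hx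
  refine ⟨?_, fun βm βp => ?_, fun j hj => DeltaInteraction.tendsto_nthEigenvalue_robinOp hx α hj⟩
  · obtain ⟨_, _, hK⟩ := DeltaInteraction.exists_hasCompactResolvent_dirichletForm hx α
    exact ⟨hK.isSelfAdjoint_operator, hK.hasPurelyDiscreteSpectrum hinf⟩
  · obtain ⟨_, _, hK⟩ := DeltaInteraction.exists_hasCompactResolvent_robinForm hx α βm βp
    exact ⟨hK.isSelfAdjoint_operator, hK.hasPurelyDiscreteSpectrum hinf⟩
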